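/- Let $n,m\ge 0$ be integers and $R>0$. Equip the superspace $\mathbb R^{n+1|2m}$, with even coordinates $x^1,\dots,x^{n+1}$ and odd coordinates $\xi^1,\eta^1,\dots,\xi^m,\eta^m$, with the Euclidean metric $$ds^2=\sum_{i=1}^{n+1}(dx^i)^2+2\sum_{\mu=1}^m d\xi^\mu\,d\eta^\mu ,$$ and let the supersphere $S^{n|2m}_R\subset\mathbb R^{n+1|2m}$ be the compact sub-supermanifold given by $$\sum_{i=1}^{n+1}(x^i)^2+2\sum_{\mu=1}^m \xi^\mu\eta^\mu=R^2 ,$$ with the induced Riemannian metric. In local coordinates $(y,\xi,\eta)$ let $g_{ab}$ be the matrix of this metric and $dV=\sqrt{\operatorname{Ber}(g_{ab})}\,D(y\,|\,\xi^1,\eta^1,\dots,\xi^m,\eta^m)$ its volume element, where $\operatorname{Ber}$ is the Berezinian; in the charts used here the odd coordinates are $\xi^\mu,\eta^\mu$, the even coordinates $y$ are all the $x^j$ with $j\neq i$, and $x^i$ is the solution of the above equation over an open hemisphere $x^i>0$ or $x^i<0$. The total volume $\operatorname{vol}(S^{n|2m}_R)$ is the Berezin integral of $dV$, computed in these charts with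 a smooth partition of unity (its value does not depend on the partition). The Berezin integral over the odd variables is normalized by $\int D(\xi,\eta)\,\eta\,\xi=1$ for each pair, so that $\int_{\mathbb R^{0|2m}}e^{-2\sum_\mu\xi^\mu\eta^\mu}\,D(\xi,\eta)=2^m$. Then $$\operatorname{vol}(S^{n|2m}_R)=2R^{\,n-2m}\,\frac{\pi^{\frac{n+1}{2}}\,2^m}{\Gamma\!\left(\frac{n+1}{2}-m\right)} ,$$ where $1/\Gamma$ is understood as $0$ at the poles $0,-1,-2,\dots$ of $\Gamma$. In particular, the supersphere $S^{2n+1|2m}_R$ has volume $0$ whenever $m>n$. -/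

import Mathlib

open scoped ContDiff

noncomputable section

namespace Supergeometry

/-! ### Grassmann algebra and the odd Berezin integral -/

/-- The real Grassmann algebra on `q` anticommuting generators. -/
abbrev Grassmann (q : ℕ) : Type := ExteriorAlgebra ℝ (Fin q → ℝ)

/-- The `j`-th generator `θ_j` (the `j`-th standard odd coordinate). -/
def theta {q : ℕ} (j : Fin q) : Grassmann q := ExteriorAlgebra.ι ℝ (Pi.single j (1 : ℝ))

/-- The body of an element: its component in degree zero. -/
def body {q : ℕ} (a : Grassmann q) : ℝ := ExteriorAlgebra.algebraMapInv a

/-- The soul of an element: its nilpotent part. -/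
def soul {q : ℕ} (a : Grassmann q) : Grassmann q := a - algebraMap ℝ (Grassmann q) (body a)

/-- The parity component of the Grassmann algebra: `p = 0` gives the even elements, `p = 1` the
odd ones. -/
def parityPart (q : ℕ) (p : ZMod 2) : Submodule ℝ (Grassmann q) :=
  CliffordAlgebra.evenOdd (0 : QuadraticForm ℝ (Fin q → ℝ)) p

/-- The left partial derivative `∂/∂θ_j`. -/
def oddDeriv {q : ℕ} (j : Fin q) : Grassmann q →ₗ[ℝ] Grassmann q :=
  CliffordAlgebra.contractLeft (Q := (0 : QuadraticForm ℝ (Fin q → ℝ))) (LinearMap.proj j)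

/-- The Berezin integral `∫ D(θ_1, …, θ_q) a = ∂_1 ∂_2 ⋯ ∂_q a`, normalized by
`∫ D(θ_1, …, θ_q) θ_q ⋯ θ_1 = 1`. -/
def oddBerezin {q : ℕ} (a : Grassmann q) : ℝ :=
  body ((List.finRange q).foldr (fun j b => oddDeriv j b) a)

/-- The value at an even element of a smooth function of one real variable: Taylor's formula at
the body, which terminates because the soul is nilpotent. -/
def evalSmooth {q : ℕ} (f : ℝ → ℝ) (a : Grassmann q) : Grassmann q :=
  ∑ k ∈ Finset.range (q + 1), (iteratedDeriv k f (body a) / (k.factorial : ℝ)) • soul a ^ k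

/-- The value at a tuple of even elements of a smooth function of `N` real variables, again by
Taylor's formula at the body. -/
def evalSmoothMulti {q N : ℕ} (f : (Fin N → ℝ) → ℝ) (a : Fin N → Grassmann q) : Grassmann q :=
  ∑ k ∈ Finset.range (q + 1), ((k.factorial : ℝ)⁻¹) •
    ∑ i : Fin k → Fin N,
      (iteratedFDeriv ℝ k f (fun A => body (a A)) (fun l => Pi.single (i l) (1 : ℝ))) •
        (List.ofFn fun l => soul (a (i l))).prod

/-! ### Berezinian -/

/-- The determinant of a square matrix by Leibniz' formula. It is only used for matrices whose
entries are even, hence commute with each other. -/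
def leibnizDet {A : Type*} [Ring A] {k : ℕ} (M : Matrix (Fin k) (Fin k) A) : A :=
  ∑ σ : Equiv.Perm (Fin k), ((Equiv.Perm.sign σ : ℤˣ) : ℤ) • (List.ofFn fun i => M (σ i) i).prod

/-- The Berezinian `det (J₀₀ - J₀₁ J₁₁⁻¹ J₁₀) / det J₁₁` of an even block matrix. -/
def berezinian {q n r : ℕ} (J : Matrix (Fin n ⊕ Fin r) (Fin n ⊕ Fin r) (Grassmann q)) :
    Grassmann q :=
  leibnizDet (J.toBlocks₁₁ - J.toBlocks₁₂ * Ring.inverse J.toBlocks₂₂ * J.toBlocks₂₁) *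
    Ring.inverse (leibnizDet J.toBlocks₂₂)

/-! ### Superfunctions and maps between superdomains -/

/-- The coefficient of a Grassmann element at the monomial indexed by `S`. -/
def coeff {q : ℕ} (S : Finset (Fin q)) (a : Grassmann q) : ℝ :=
  (Pi.basisFun ℝ (Fin q)).ExteriorAlgebra.repr a S

/-- `f = ∑ f_S(x) θ^S` is a smooth superfunction over the open set `U`. -/
def SuperSmoothOn {n q : ℕ} (f : (Fin n → ℝ) → Grassmann q) (U : Set (Fin n → ℝ)) : Prop :=
  ∀ S : Finset (Fin q), ContDiffOn ℝ ∞ (fun x => coeff S (f x)) U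

/-- The partial derivative of a superfunction in the `j`-th even coordinate, taken
coefficientwise. -/
def evenDeriv {n q : ℕ} (j : Fin n) (f : (Fin n → ℝ) → Grassmann q) (x : Fin n → ℝ) :
    Grassmann q :=
  ∑ S : Finset (Fin q), (fderiv ℝ (fun y => coeff S (f y)) x (Pi.single j (1 : ℝ))) •
    (Pi.basisFun ℝ (Fin q)).ExteriorAlgebra S

/-- The (left) partial derivative of a superfunction in the coordinate `a`, even or odd. -/
def superDeriv {n q : ℕ} (a : Fin n ⊕ Fin q) (f : (Fin n → ℝ) → Grassmann q)
    (x : Fin n → ℝ) : Grassmann q :=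
  Sum.elim (fun j => evenDeriv j f x) (fun j => oddDeriv j (f x)) a

/-- The parity of a coordinate: `0` for even coordinates, `1` for odd ones. -/
def coordParity {n q : ℕ} : Fin n ⊕ Fin q → ℕ := Sum.elim (fun _ => 0) (fun _ => 1)

/-- A smooth map from a superdomain of dimension `n|q` to `ℝ^{N|Q}`, given by the pullbacks of the
standard coordinates. -/
structure SuperMap (n q N Q : ℕ) where
  domain : Set (Fin n → ℝ)
  isOpen_domain : IsOpen domain
  coord : Fin N ⊕ Fin Q → (Fin n → ℝ) → Grassmann q
  smooth : ∀ A, SuperSmoothOn (coord A) domain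
  parity : ∀ A, ∀ x ∈ domain, coord A x ∈ parityPart q (coordParity A : ZMod 2)

/-- The pullback `Φ^* ρ` of an ordinary smooth function `ρ(x^1, …, x^N)` of the even
coordinates. -/
def SuperMap.pullback {n q N Q : ℕ} (Φ : SuperMap n q N Q) (ρ : (Fin N → ℝ) → ℝ)
    (x : Fin n → ℝ) : Grassmann q :=
  evalSmoothMulti ρ (fun A => Φ.coord (Sum.inl A) x)

/-- The matrix of the metric induced by `Φ` from the constant even metric `G_{AB}` on `ℝ^{N|Q}`:
`g_{ab} = ∑ (-1)^{|A| (|B| + |b|)} (∂_a Φ^A) (∂_b Φ^B) G_{AB}`. -/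
def SuperMap.inducedMetric {n q N Q : ℕ} (Φ : SuperMap n q N Q)
    (G : Matrix (Fin N ⊕ Fin Q) (Fin N ⊕ Fin Q) ℝ) (x : Fin n → ℝ) :
    Matrix (Fin n ⊕ Fin q) (Fin n ⊕ Fin q) (Grassmann q) :=
  Matrix.of fun a b => ∑ A, ∑ B,
    ((-1 : ℝ) ^ (coordParity A * (coordParity B + coordParity b)) * G A B) •
      (superDeriv a (Φ.coord A) x * superDeriv b (Φ.coord B) x)

/-- The density `√(Ber g)` of the Riemannian volume element with respect to the coordinate volume
element `D(x, θ)`. -/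
def SuperMap.volumeDensity {n q N Q : ℕ} (Φ : SuperMap n q N Q)
    (G : Matrix (Fin N ⊕ Fin Q) (Fin N ⊕ Fin Q) ℝ) (x : Fin n → ℝ) : Grassmann q :=
  evalSmooth Real.sqrt (berezinian (Φ.inducedMetric G x))

/-- The function of the even coordinates obtained from `(Φ^* ρ) √(Ber g)` by Berezin integration
over the odd coordinates. -/
def SuperMap.integrand {n q N Q : ℕ} (Φ : SuperMap n q N Q)
    (G : Matrix (Fin N ⊕ Fin Q) (Fin N ⊕ Fin Q) ℝ) (ρ : (Fin N → ℝ) → ℝ)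
    (x : Fin n → ℝ) : ℝ :=
  oddBerezin (Φ.pullback ρ x * Φ.volumeDensity G x)

/-! ### The supersphere in `ℝ^{n+1|2m}` -/

/-- The index of the odd coordinate `ξ^μ` in the order `ξ^1, η^1, …, ξ^m, η^m`. -/
def xiIdx {m : ℕ} (μ : Fin m) : Fin (2 * m) := ⟨2 * μ.1, by omega⟩

/-- The index of the odd coordinate `η^μ` in the order `ξ^1, η^1, …, ξ^m, η^m`. -/
def etaIdx {m : ℕ} (μ : Fin m) : Fin (2 * m) := ⟨2 * μ.1 + 1, by omega⟩

/-- The matrix `G_{AB}` of the Euclidean metric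
`ds² = ∑ (dx^i)² + 2 ∑ dξ^μ dη^μ = dx^A dx^B G_{BA}` on `ℝ^{N|2m}`: the identity matrix in the
even-even block, and `G_{ηξ} = 1 = -G_{ξη}` in the odd-odd block. -/
def euclideanMetric (N m : ℕ) : Matrix (Fin N ⊕ Fin (2 * m)) (Fin N ⊕ Fin (2 * m)) ℝ :=
  Matrix.fromBlocks 1 0 0 (Matrix.of fun i j => ∑ μ : Fin m,
    ((if i = etaIdx μ ∧ j = xiIdx μ then 1 else 0) -
      (if i = xiIdx μ ∧ j = etaIdx μ then 1 else 0)))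

/-- `∑ (x^i)² + 2 ∑ ξ^μ η^μ`, evaluated on the components of a map to `ℝ^{N|2m}`. -/
def SuperMap.scalarSquare {n q N m : ℕ} (Φ : SuperMap n q N (2 * m)) (x : Fin n → ℝ) :
    Grassmann q :=
  ∑ i, Φ.coord (Sum.inl i) x ^ 2 +
    (2 : ℝ) • ∑ μ : Fin m, Φ.coord (Sum.inr (xiIdx μ)) x * Φ.coord (Sum.inr (etaIdx μ)) x

/-- `Φ` is the standard chart of the supersphere `∑ (x^i)² + 2 ∑ ξ^μ η^μ = R²` over the open
hemisphere `ε x^i > 0`: the coordinates are the odd coordinates and all even coordinates other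
than `x^i`, and `x^i` is expressed through them by solving the equation of the supersphere. -/
structure IsHemisphereChart {n m : ℕ} (R : ℝ) (i : Fin (n + 1)) (ε : ℤˣ)
    (Φ : SuperMap n (2 * m) (n + 1) (2 * m)) : Prop where
  domain_eq : Φ.domain = {y | ∑ j, y j ^ 2 < R ^ 2}
  coord_odd : ∀ y ∈ Φ.domain, ∀ j, Φ.coord (Sum.inr j) y = theta j
  coord_even : ∀ y ∈ Φ.domain, ∀ j : Fin n,
    Φ.coord (Sum.inl (i.succAbove j)) y = algebraMap ℝ (Grassmann (2 * m)) (y j)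
  sign : ∀ y ∈ Φ.domain, 0 < ((ε : ℤ) : ℝ) * body (Φ.coord (Sum.inl i) y)
  sphere_eq : ∀ y ∈ Φ.domain,
    Φ.scalarSquare y = algebraMap ℝ (Grassmann (2 * m)) (R ^ 2)

/-- The `2(n+1)` hemisphere charts, which cover the supersphere. -/
def IsHemisphereAtlas {n m : ℕ} (R : ℝ)
    (Φ : Fin (n + 1) × ℤˣ → SuperMap n (2 * m) (n + 1) (2 * m)) : Prop :=
  ∀ α, IsHemisphereChart R α.1 α.2 (Φ α)

/-- A smooth partition of unity near the sphere `|x| = R` in `ℝ^{n+1}`, subordinate to its cover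
by the open hemispheres. Pulled back to the supersphere, it is a partition of unity there. -/
structure IsHemispherePartition {n : ℕ} (R : ℝ)
    (ρ : Fin (n + 1) × ℤˣ → (Fin (n + 1) → ℝ) → ℝ) : Prop where
  smooth : ∀ α, ContDiff ℝ ∞ (ρ α)
  support : ∀ α, ∀ x ∈ tsupport (ρ α), ∑ i, x i ^ 2 = R ^ 2 → 0 < ((α.2 : ℤ) : ℝ) * x α.1
  sum_eq_one : ∀ x : Fin (n + 1) → ℝ, ∑ i, x i ^ 2 = R ^ 2 →
    ∀ᶠ z in nhds x, ∑ α, ρ α z = 1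

/-- The supersphere of radius `R` and dimension `n|2m` has total volume `V` with respect to the
Riemannian volume element of the metric induced from `ℝ^{n+1|2m}`: there are partitions of unity
subordinate to the atlas, and for each of them the Berezin integrals over the charts converge and
add up to `V`. -/
def HasSupersphereVolume (n m : ℕ) (R V : ℝ) : Prop :=
  (∃ Φ : Fin (n + 1) × ℤˣ → SuperMap n (2 * m) (n + 1) (2 * m), IsHemisphereAtlas R Φ) ∧
  (∃ ρ : Fin (n + 1) × ℤˣ → (Fin (n + 1) → ℝ) → ℝ, IsHemispherePartition R ρ) ∧
  ∀ (Φ : Fin (n + 1) × ℤˣ → SuperMap n (2 * m) (n + 1) (2 * m))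
    (ρ : Fin (n + 1) × ℤˣ → (Fin (n + 1) → ℝ) → ℝ),
    IsHemisphereAtlas R Φ → IsHemispherePartition R ρ →
    (∀ α, MeasureTheory.IntegrableOn ((Φ α).integrand (euclideanMetric (n + 1) m) (ρ α))
      (Φ α).domain MeasureTheory.volume) ∧
    ∑ α, ∫ y in (Φ α).domain, (Φ α).integrand (euclideanMetric (n + 1) m) (ρ α) y = V

end Supergeometry

end

/-!
Over an open hemisphere of sign `ε` the sphere equation is solved by `x^i = ε √(R² - |y|² + ω)`,
where `ω = -2 ∑ ξη` is nilpotent, and the induced metric has Berezinian `(R / x^i)²`. Since `ω ^ k`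
contributes to the Berezin integral only for `k = m`, where it integrates to `2 ^ m m!`, integrating
the Taylor expansion in `ω` over the odd variables amounts to applying `2 ^ m (d/dw)^m` at
`w = R² - |y|²`. The volume density in a chart is therefore `2 ^ m R` times the `m`-th derivative
in `w` of `ρ(y, ε√w) / √w`.

Moving the derivative onto the parameter `r = R²` and summing over the charts, the total volume is
`2 ^ m R` times the `m`-th derivative in `r` of a classical quantity: the density of the
distribution of `|x|²` under twice Lebesgue measure on `ℝ^{n+1}`, which is `2 π^s / Γ(s) r^{s-1}`
with `s = (n + 1) / 2`. The `m` factors brought down by the derivatives turn `1 / Γ(s)` into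
`1 / Γ(s - m)`, and their product vanishes exactly when `s - m` is a pole.
-/

noncomputable section

namespace Supergeometry

open MeasureTheory
open scoped Matrix

/-! ### Even elements of the Grassmann algebra -/

section Grassmann

variable {q : ℕ}

theorem body_add (a b : Grassmann q) : body (a + b) = body a + body b := map_add _ a b

theorem body_mul (a b : Grassmann q) : body (a * b) = body a * body b := map_mul _ a b

theorem body_pow (a : Grassmann q) (k : ℕ) : body (a ^ k) = body a ^ k := map_pow _ a k

theorem body_smul (r : ℝ) (a : Grassmann q) : body (r • a) = r * body a :=
  map_smul (ExteriorAlgebra.algebraMapInv (R := ℝ) (M := Fin q → ℝ)) r a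

theorem body_sum {ι : Type*} (s : Finset ι) (f : ι → Grassmann q) :
    body (∑ i ∈ s, f i) = ∑ i ∈ s, body (f i) := map_sum _ _ _

theorem body_algebraMap (r : ℝ) : body (algebraMap ℝ (Grassmann q) r) = r :=
  ExteriorAlgebra.algebraMap_leftInverse _ r

theorem body_zero : body (0 : Grassmann q) = 0 := map_zero _

theorem body_ι (v : Fin q → ℝ) : body (ExteriorAlgebra.ι ℝ v) = 0 := by
  simp [body, ExteriorAlgebra.algebraMapInv]

theorem body_theta (j : Fin q) : body (theta j) = 0 := body_ι _

theorem algebraMap_add_soul (x : Grassmann q) :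
    algebraMap ℝ (Grassmann q) (body x) + soul x = x := by simp [soul]

theorem ι_mul_ι_swap (v w : Fin q → ℝ) :
    ExteriorAlgebra.ι ℝ v * ExteriorAlgebra.ι ℝ w =
      -(ExteriorAlgebra.ι ℝ w * ExteriorAlgebra.ι ℝ v) :=
  eq_neg_of_add_eq_zero_left (ExteriorAlgebra.ι_add_mul_swap v w)

theorem theta_mul_self (i : Fin q) : (theta i * theta i : Grassmann q) = 0 :=
  ExteriorAlgebra.ι_sq_zero _

theorem ι_mul_ι_sq (v w : Fin q → ℝ) :
    (ExteriorAlgebra.ι ℝ v * ExteriorAlgebra.ι ℝ w) ^ 2 = 0 := by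
  rw [pow_two, mul_assoc, ← mul_assoc (ExteriorAlgebra.ι ℝ w), ι_mul_ι_swap w v, neg_mul, mul_neg,
    mul_assoc, ExteriorAlgebra.ι_sq_zero, mul_zero, mul_zero, neg_zero]

theorem theta_mul_theta_sq (i j : Fin q) : (theta i * theta j : Grassmann q) ^ 2 = 0 :=
  ι_mul_ι_sq _ _

theorem even_algebraMap (r : ℝ) : algebraMap ℝ (Grassmann q) r ∈ parityPart q 0 :=
  (CliffordAlgebra.even (0 : QuadraticForm ℝ (Fin q → ℝ))).algebraMap_mem r

theorem even_smul (r : ℝ) {x : Grassmann q} (hx : x ∈ parityPart q 0) : r • x ∈ parityPart q 0 :=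
  Submodule.smul_mem _ r hx

theorem even_mul {x y : Grassmann q} (hx : x ∈ parityPart q 0) (hy : y ∈ parityPart q 0) :
    x * y ∈ parityPart q 0 :=
  (CliffordAlgebra.even (0 : QuadraticForm ℝ (Fin q → ℝ))).mul_mem hx hy

theorem even_pow {x : Grassmann q} (hx : x ∈ parityPart q 0) (k : ℕ) : x ^ k ∈ parityPart q 0 :=
  (CliffordAlgebra.even (0 : QuadraticForm ℝ (Fin q → ℝ))).pow_mem hx k

theorem even_soul {x : Grassmann q} (hx : x ∈ parityPart q 0) : soul x ∈ parityPart q 0 :=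
  sub_mem hx (even_algebraMap _)

theorem even_ι_mul_ι (v w : Fin q → ℝ) :
    ExteriorAlgebra.ι ℝ v * ExteriorAlgebra.ι ℝ w ∈ parityPart q 0 :=
  CliffordAlgebra.ι_mul_ι_mem_evenOdd_zero _ _ _

theorem even_theta_mul_theta (i j : Fin q) : (theta i * theta j : Grassmann q) ∈ parityPart q 0 :=
  even_ι_mul_ι _ _

theorem odd_ι (v : Fin q → ℝ) : ExteriorAlgebra.ι ℝ v ∈ parityPart q 1 :=
  CliffordAlgebra.ι_mem_evenOdd_one _ _

theorem odd_theta (i : Fin q) : (theta i : Grassmann q) ∈ parityPart q 1 := odd_ι _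

theorem odd_smul (r : ℝ) {x : Grassmann q} (hx : x ∈ parityPart q 1) : r • x ∈ parityPart q 1 :=
  Submodule.smul_mem _ r hx

theorem even_mul_odd {x y : Grassmann q} (hx : x ∈ parityPart q 0) (hy : y ∈ parityPart q 1) :
    x * y ∈ parityPart q 1 := by
  have hxy : x * y ∈ CliffordAlgebra.evenOdd (0 : QuadraticForm ℝ (Fin q → ℝ)) (0 + 1) :=
    SetLike.mul_mem_graded hx hy
  rwa [zero_add] at hxy

theorem odd_mul_odd {x y : Grassmann q} (hx : x ∈ parityPart q 1) (hy : y ∈ parityPart q 1) :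
    x * y ∈ parityPart q 0 := by
  have hxy : x * y ∈ CliffordAlgebra.evenOdd (0 : QuadraticForm ℝ (Fin q → ℝ)) (1 + 1) :=
    SetLike.mul_mem_graded hx hy
  rwa [CharTwo.add_self_eq_zero] at hxy

theorem even_induction {motive : ∀ x, x ∈ parityPart q 0 → Prop}
    (algebraMap : ∀ r : ℝ, motive (algebraMap ℝ _ r) (even_algebraMap r))
    (add : ∀ x y hx hy, motive x hx → motive y hy → motive (x + y) (add_mem hx hy))
    (ι_mul_ι_mul : ∀ v w x hx, motive x hx →
      motive (ExteriorAlgebra.ι ℝ v * ExteriorAlgebra.ι ℝ w * x) (even_mul (even_ι_mul_ι v w) hx))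
    (x : Grassmann q) (hx : x ∈ parityPart q 0) : motive x hx :=
  CliffordAlgebra.even_induction _ algebraMap add ι_mul_ι_mul x hx

theorem odd_induction {motive : ∀ x, x ∈ parityPart q 1 → Prop}
    (ι : ∀ v : Fin q → ℝ, motive (ExteriorAlgebra.ι ℝ v) (odd_ι v))
    (add : ∀ x y hx hy, motive x hx → motive y hy → motive (x + y) (add_mem hx hy))
    (ι_mul_ι_mul : ∀ v w x hx, motive x hx → motive
      (ExteriorAlgebra.ι ℝ v * ExteriorAlgebra.ι ℝ w * x) (even_mul_odd (even_ι_mul_ι v w) hx))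
    (x : Grassmann q) (hx : x ∈ parityPart q 1) : motive x hx :=
  CliffordAlgebra.odd_induction _ ι add ι_mul_ι_mul x hx

theorem even_commute_ι {x : Grassmann q} (hx : x ∈ parityPart q 0) (v : Fin q → ℝ) :
    Commute x (ExteriorAlgebra.ι ℝ v) := by
  induction x, hx using even_induction with
  | algebraMap r => exact Algebra.commutes r _
  | add x y _ _ ihx ihy => exact ihx.add_left ihy
  | ι_mul_ι_mul w w' x _ ih =>
    refine Commute.mul_left ?_ ih
    rw [Commute, SemiconjBy, mul_assoc, ι_mul_ι_swap w' v, mul_neg, ← mul_assoc, ι_mul_ι_swap w v,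
      neg_mul, neg_neg, mul_assoc]

theorem even_commute {x : Grassmann q} (hx : x ∈ parityPart q 0) (y : Grassmann q) :
    Commute x y := by
  induction y using ExteriorAlgebra.induction with
  | algebraMap r => exact (Algebra.commutes r x).symm
  | ι v => exact even_commute_ι hx v
  | mul a b ha hb => exact ha.mul_right hb
  | add a b ha hb => exact ha.add_right hb

theorem odd_mul_ι_swap {x : Grassmann q} (hx : x ∈ parityPart q 1) (v : Fin q → ℝ) :
    x * ExteriorAlgebra.ι ℝ v = -(ExteriorAlgebra.ι ℝ v * x) := by
  induction x, hx using odd_induction with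
  | ι w => exact ι_mul_ι_swap w v
  | add x y _ _ ihx ihy => rw [add_mul, mul_add, ihx, ihy, neg_add]
  | ι_mul_ι_mul w w' x _ ih =>
    rw [mul_assoc, ih, mul_neg, ← mul_assoc, (even_commute_ι (even_ι_mul_ι w w') v).eq, mul_assoc]

theorem odd_mul_odd_swap {x y : Grassmann q} (hx : x ∈ parityPart q 1) (hy : y ∈ parityPart q 1) :
    x * y = -(y * x) := by
  induction y, hy using odd_induction with
  | ι v => exact odd_mul_ι_swap hx v
  | add y z _ _ ihy ihz => rw [mul_add, add_mul, ihy, ihz, neg_add]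
  | ι_mul_ι_mul v w y _ ih =>
    rw [← mul_assoc, ← (even_commute (even_ι_mul_ι v w) x).eq, mul_assoc, ih, mul_neg,
      ← mul_assoc]

theorem odd_mul_self {x : Grassmann q} (hx : x ∈ parityPart q 1) : x * x = 0 := by
  have two_smul_eq_zero : (2 : ℝ) • (x * x) = 0 := by
    rw [two_smul]
    exact eq_neg_iff_add_eq_zero.mp (odd_mul_odd_swap hx hx)
  exact (smul_eq_zero.mp two_smul_eq_zero).resolve_left two_ne_zero

theorem isNilpotent_soul {x : Grassmann q} (hx : x ∈ parityPart q 0) : IsNilpotent (soul x) := by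
  induction x, hx using even_induction with
  | algebraMap r => simp [soul, body_algebraMap]
  | add x y hx _ ihx ihy =>
    have soul_add : soul (x + y) = soul x + soul y := by
      simp only [soul, body_add, map_add]; abel
    rw [soul_add]
    exact (even_commute (even_soul hx) _).isNilpotent_add ihx ihy
  | ι_mul_ι_mul v w x _ _ =>
    have soul_eq : soul (ExteriorAlgebra.ι ℝ v * ExteriorAlgebra.ι ℝ w * x) =
        ExteriorAlgebra.ι ℝ v * ExteriorAlgebra.ι ℝ w * x := by
      rw [soul, body_mul, body_mul, body_ι, zero_mul, zero_mul, map_zero, sub_zero]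
    refine ⟨2, ?_⟩
    rw [soul_eq, (even_commute (even_ι_mul_ι v w) x).mul_pow, ι_mul_ι_sq, zero_mul]

theorem exists_even_mul_eq_one {x : Grassmann q} (hx : x ∈ parityPart q 0) (hb : body x ≠ 0) :
    ∃ y ∈ parityPart q 0, x * y = 1 := by
  let E := CliffordAlgebra.even (0 : QuadraticForm ℝ (Fin q → ℝ))
  have hnil : IsNilpotent (⟨soul x, even_soul hx⟩ : E) :=
    (IsNilpotent.map_iff (f := E.val) Subtype.val_injective).mp (isNilpotent_soul hx)
  have hunit : IsUnit (⟨soul x, even_soul hx⟩ + algebraMap ℝ E (body x)) :=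
    hnil.isUnit_add_right_of_commute ((IsUnit.mk0 _ hb).map (algebraMap ℝ E))
      (Algebra.commutes _ _).symm
  obtain ⟨y, hy⟩ := hunit.exists_right_inv
  refine ⟨y, y.2, ?_⟩
  rw [← algebraMap_add_soul x, add_comm]
  exact congrArg Subtype.val hy

theorem isUnit_of_body_ne_zero {x : Grassmann q} (hx : x ∈ parityPart q 0) (hb : body x ≠ 0) :
    IsUnit x := by
  obtain ⟨y, -, hxy⟩ := exists_even_mul_eq_one hx hb
  exact ⟨⟨x, y, hxy, (even_commute hx y).eq ▸ hxy⟩, rfl⟩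

theorem even_eq_of_sq_eq {x y : Grassmann q} (hx : x ∈ parityPart q 0) (hy : y ∈ parityPart q 0)
    (h : x ^ 2 = y ^ 2) (hb : body x + body y ≠ 0) : x = y := by
  have hunit : IsUnit (x + y) := isUnit_of_body_ne_zero (add_mem hx hy) (by rwa [body_add])
  have hzero : (x + y) * (x - y) = 0 := by
    rw [← (even_commute hx y).sq_sub_sq, h, sub_self]
  exact sub_eq_zero.mp (hunit.mul_right_eq_zero.mp hzero)

theorem oddDeriv_ι_mul (j : Fin q) (v : Fin q → ℝ) (b : Grassmann q) :
    oddDeriv j (ExteriorAlgebra.ι ℝ v * b) = v j • b - ExteriorAlgebra.ι ℝ v * oddDeriv j b :=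
  CliffordAlgebra.contractLeft_ι_mul _ _ _

theorem oddDeriv_theta_mul (j k : Fin q) (b : Grassmann q) :
    oddDeriv j (theta k * b) = (if j = k then b else 0) - theta k * oddDeriv j b := by
  rw [theta, oddDeriv_ι_mul, Pi.single_apply]
  split_ifs <;> simp

theorem oddDeriv_algebraMap (j : Fin q) (r : ℝ) : oddDeriv j (algebraMap ℝ (Grassmann q) r) = 0 :=
  CliffordAlgebra.contractLeft_algebraMap _ _ _

theorem oddDeriv_one (j : Fin q) : oddDeriv j (1 : Grassmann q) = 0 :=
  CliffordAlgebra.contractLeft_one (0 : QuadraticForm ℝ (Fin q → ℝ)) _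

theorem oddDeriv_theta (j k : Fin q) :
    oddDeriv j (theta k : Grassmann q) = if j = k then 1 else 0 := by
  have h := oddDeriv_theta_mul j k 1
  rwa [mul_one, oddDeriv_one, mul_zero, sub_zero] at h

theorem oddDeriv_even_mul (j : Fin q) {x : Grassmann q} (hx : x ∈ parityPart q 0)
    (b : Grassmann q) : oddDeriv j (x * b) = oddDeriv j x * b + x * oddDeriv j b := by
  induction x, hx using even_induction with
  | algebraMap r =>
    rw [oddDeriv_algebraMap, zero_mul, zero_add, ← Algebra.smul_def, map_smul, Algebra.smul_def]
  | add x y _ _ ihx ihy => rw [add_mul, map_add, ihx, ihy, map_add, add_mul, add_mul]; abel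
  | ι_mul_ι_mul v w x _ ih =>
    simp only [mul_assoc, oddDeriv_ι_mul, ih, mul_sub, sub_mul, mul_add, smul_mul_assoc,
      mul_smul_comm]
    abel

theorem oddDeriv_even_pow (j : Fin q) {x : Grassmann q} (hx : x ∈ parityPart q 0) (k : ℕ) :
    oddDeriv j (x ^ k) = k • (x ^ (k - 1) * oddDeriv j x) := by
  induction k with
  | zero => rw [pow_zero, zero_smul, oddDeriv_one]
  | succ k ih =>
    rw [pow_succ', oddDeriv_even_mul j hx, ih, Nat.add_sub_cancel, mul_smul_comm, ← mul_assoc]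
    rcases Nat.eq_zero_or_pos k with rfl | hk
    · simp
    · rw [← pow_succ', Nat.sub_add_cancel hk, ← ((even_commute hx _).pow_left k).eq, add_smul,
        one_smul, add_comm]

theorem oddBerezin_eq_body_prod (a : Grassmann q) :
    oddBerezin a =
      body (((List.finRange q).map (oddDeriv : Fin q → Module.End ℝ (Grassmann q))).prod a) := by
  have foldr_eq (L : List (Fin q)) : L.foldr (fun j b => oddDeriv j b) a =
      (L.map (oddDeriv : Fin q → Module.End ℝ (Grassmann q))).prod a := by
    induction L with
    | nil => rfl
    | cons j L ih => rw [List.foldr_cons, ih, List.map_cons, List.prod_cons, Module.End.mul_apply]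
  rw [oddBerezin, foldr_eq]

theorem oddBerezin_smul (r : ℝ) (a : Grassmann q) : oddBerezin (r • a) = r * oddBerezin a := by
  rw [oddBerezin_eq_body_prod, map_smul, body_smul, ← oddBerezin_eq_body_prod]

theorem oddBerezin_sum {ι : Type*} (s : Finset ι) (f : ι → Grassmann q) :
    oddBerezin (∑ i ∈ s, f i) = ∑ i ∈ s, oddBerezin (f i) := by
  simp only [oddBerezin_eq_body_prod, map_sum, body_sum]

end Grassmann

/-! ### The element `-2 ∑ ξη` -/

section OddSquare

variable {m : ℕ}

/-- The odd part `-2 ∑ ξ^μ η^μ = 2 ∑ η^μ ξ^μ` of the equation of the supersphere, moved to the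
right-hand side: on the sphere of radius `R`, `∑ (x^i)² = R² + oddSquare m`. -/
def oddSquare (m : ℕ) : Grassmann (2 * m) :=
  (2 : ℝ) • ∑ μ : Fin m, theta (etaIdx μ) * theta (xiIdx μ)

theorem xiIdx_inj {μ ν : Fin m} : xiIdx μ = xiIdx ν ↔ μ = ν := by
  simp [xiIdx, Fin.ext_iff]

theorem etaIdx_inj {μ ν : Fin m} : etaIdx μ = etaIdx ν ↔ μ = ν := by
  simp [etaIdx, Fin.ext_iff]

theorem xiIdx_ne_etaIdx (μ ν : Fin m) : xiIdx μ ≠ etaIdx ν := by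
  simp only [xiIdx, etaIdx, ne_eq, Fin.ext_iff]; omega

theorem finRange_two_mul (m : ℕ) :
    List.finRange (2 * m) = (List.finRange m).flatMap fun μ => [xiIdx μ, etaIdx μ] := by
  have range_two_mul :
      List.range (2 * m) = (List.range m).flatMap fun μ => [2 * μ, 2 * μ + 1] := by
    induction m with
    | zero => rfl
    | succ m ih =>
      rw [List.range_succ, List.flatMap_append, ← ih, Nat.mul_succ, List.range_succ,
        List.range_succ]
      simp
  apply List.map_injective_iff.mpr Fin.val_injective
  rw [List.map_coe_finRange_eq_range, range_two_mul, List.map_flatMap,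
    ← List.map_coe_finRange_eq_range, List.flatMap_map]
  rfl

theorem even_oddSquare (m : ℕ) : oddSquare m ∈ parityPart (2 * m) 0 :=
  even_smul _ (sum_mem fun _ _ => even_theta_mul_theta _ _)

theorem body_oddSquare (m : ℕ) : body (oddSquare m) = 0 := by
  simp [oddSquare, body_smul, body_sum, body_mul, body_theta]

theorem sum_theta_mul_theta_pow_eq_zero (s : Finset (Fin m)) :
    (∑ μ ∈ s, (theta (etaIdx μ) * theta (xiIdx μ) : Grassmann (2 * m))) ^ (s.card + 1) = 0 := by
  induction s using Finset.induction_on with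
  | empty => simp
  | insert a s ha ih =>
    rw [Finset.sum_insert ha, Finset.card_insert_of_notMem ha]
    exact (even_commute (even_theta_mul_theta _ _) _).add_pow_eq_zero_of_add_le_succ_of_pow_eq_zero
      (theta_mul_theta_sq _ _) ih (by omega)

theorem oddSquare_pow_eq_zero {k : ℕ} (hk : m < k) : oddSquare m ^ k = 0 := by
  refine pow_eq_zero_of_le hk ?_
  have h := sum_theta_mul_theta_pow_eq_zero (Finset.univ : Finset (Fin m))
  rw [Finset.card_univ, Fintype.card_fin] at h
  rw [oddSquare, smul_pow, h, smul_zero]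

theorem oddDeriv_xi_oddDeriv_eta_pow (μ : Fin m) {w : Grassmann (2 * m)}
    (hw : w ∈ parityPart (2 * m) 0) (hξ : oddDeriv (xiIdx μ) w = 0)
    (hη : oddDeriv (etaIdx μ) w = 0) (p : ℕ) :
    oddDeriv (xiIdx μ) (oddDeriv (etaIdx μ)
      (((2 : ℝ) • (theta (etaIdx μ) * theta (xiIdx μ)) + w) ^ p)) = (2 * p : ℝ) • w ^ (p - 1) := by
  set e : Grassmann (2 * m) := (2 : ℝ) • (theta (etaIdx μ) * theta (xiIdx μ)) with e_def
  have even_e : e ∈ parityPart (2 * m) 0 := even_smul _ (even_theta_mul_theta _ _)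
  have oddDeriv_e : oddDeriv (etaIdx μ) e = (2 : ℝ) • theta (xiIdx μ) := by
    rw [e_def, map_smul, oddDeriv_theta_mul, if_pos rfl, oddDeriv_theta,
      if_neg (xiIdx_ne_etaIdx μ μ).symm, mul_zero, sub_zero]
  have add_pow_mul_theta (k : ℕ) : (e + w) ^ k * theta (xiIdx μ) = theta (xiIdx μ) * w ^ k := by
    have e_mul_theta : e * theta (xiIdx μ) = 0 := by
      rw [e_def, smul_mul_assoc, mul_assoc, theta_mul_self, mul_zero, smul_zero]
    induction k with
    | zero => simp
    | succ k ih =>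
      rw [pow_succ, mul_assoc, add_mul, e_mul_theta, zero_add, (even_commute hw _).eq,
        ← mul_assoc, ih, mul_assoc, pow_succ]
  rw [oddDeriv_even_pow _ (add_mem even_e hw), map_add, hη, add_zero, oddDeriv_e, mul_smul_comm,
    add_pow_mul_theta, ← Nat.cast_smul_eq_nsmul ℝ, smul_smul, map_smul, oddDeriv_theta_mul,
    if_pos rfl, oddDeriv_even_pow _ hw, hξ, mul_zero, smul_zero, mul_zero, sub_zero,
    mul_comm (p : ℝ)]

theorem foldr_oddDeriv_pow (L : List (Fin m)) (hL : L.Nodup) {w : Grassmann (2 * m)}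
    (hw : w ∈ parityPart (2 * m) 0)
    (hd : ∀ μ ∈ L, oddDeriv (xiIdx μ) w = 0 ∧ oddDeriv (etaIdx μ) w = 0) (j : ℕ) :
    L.foldr (fun μ b => oddDeriv (xiIdx μ) (oddDeriv (etaIdx μ) b))
      (((L.map fun μ => (2 : ℝ) • (theta (etaIdx μ) * theta (xiIdx μ) : Grassmann (2 * m))).sum
        + w) ^ j) = ((2 : ℝ) ^ L.length * (j.descFactorial L.length : ℝ)) • w ^ (j - L.length) := by
  induction L generalizing w with
  | nil => simp
  | cons μ L ih =>
    obtain ⟨hμ, hL⟩ := List.nodup_cons.mp hL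
    obtain ⟨hξ, hη⟩ := hd μ List.mem_cons_self
    have even_add : (2 : ℝ) • (theta (etaIdx μ) * theta (xiIdx μ)) + w ∈ parityPart (2 * m) 0 :=
      add_mem (even_smul _ (even_theta_mul_theta _ _)) hw
    have oddDeriv_add : ∀ ν ∈ L,
        oddDeriv (xiIdx ν) ((2 : ℝ) • (theta (etaIdx μ) * theta (xiIdx μ)) + w) = 0 ∧
          oddDeriv (etaIdx ν) ((2 : ℝ) • (theta (etaIdx μ) * theta (xiIdx μ)) + w) = 0 := by
      intro ν hν
      have hne : ν ≠ μ := ne_of_mem_of_not_mem hν hμ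
      have hw' := hd ν (List.mem_cons_of_mem _ hν)
      constructor <;>
      simp [oddDeriv_theta_mul, oddDeriv_theta, xiIdx_inj, etaIdx_inj, hne, xiIdx_ne_etaIdx,
        (xiIdx_ne_etaIdx _ _).symm, hw'.1, hw'.2]
    rw [List.foldr_cons, List.map_cons, List.sum_cons, add_assoc, add_left_comm,
      ih hL even_add oddDeriv_add, map_smul, map_smul, oddDeriv_xi_oddDeriv_eta_pow μ hw hξ hη,
      smul_smul, List.length_cons, Nat.descFactorial_succ, Nat.sub_sub]
    congr 1
    push_cast; ring

theorem oddBerezin_oddSquare_pow (m k : ℕ) :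
    oddBerezin (oddSquare m ^ k) = if k = m then 2 ^ m * (m.factorial : ℝ) else 0 := by
  have hfold := foldr_oddDeriv_pow (List.finRange m) (List.nodup_finRange m) (zero_mem _)
    (fun μ _ => by simp) k
  have hsum : ((List.finRange m).map fun μ =>
      (2 : ℝ) • (theta (etaIdx μ) * theta (xiIdx μ) : Grassmann (2 * m))).sum = oddSquare m := by
    rw [oddSquare, Finset.smul_sum, ← List.ofFn_eq_map, List.sum_ofFn]
  rw [hsum, add_zero, List.length_finRange] at hfold
  rw [oddBerezin, finRange_two_mul, List.foldr_flatMap]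
  simp only [List.foldr_cons, List.foldr_nil]
  rw [hfold, body_smul, body_pow, body_zero]
  rcases lt_trichotomy k m with hk | rfl | hk
  · rw [Nat.descFactorial_eq_zero_iff_lt.mpr hk, if_neg hk.ne]; simp
  · simp [Nat.descFactorial_self]
  · rw [if_neg hk.ne', zero_pow (by omega), mul_zero]

end OddSquare

/-! ### The Berezinian of a rank-one perturbation -/

section Determinant

variable {C : Type*} [CommRing C]

theorem det_one_add_submatrix {α β : Type*} [Fintype α] [DecidableEq α] [Fintype β]
    [DecidableEq β] (P : Matrix β β C) (e : α ≃ β) : (1 + P.submatrix e e).det = (1 + P).det := by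
  rw [← Matrix.det_submatrix_equiv_self e (1 + P), ← Matrix.submatrix_one_equiv e]
  rfl

theorem det_one_add_sum_punit {α : Type*} [Fintype α] [DecidableEq α]
    (P : Matrix (α ⊕ PUnit) (α ⊕ PUnit) C)
    (hperm : ∀ i j i' j', P i j * P i' j' = -(P i j' * P i' j))
    (hsq : P (.inr ⟨⟩) (.inr ⟨⟩) * P (.inr ⟨⟩) (.inr ⟨⟩) = 0) :
    (1 + P).det = (1 + P (.inr ⟨⟩) (.inr ⟨⟩)) *
      (1 + (1 + P (.inr ⟨⟩) (.inr ⟨⟩)) • P.toBlocks₁₁).det := by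
  set e := P (.inr ⟨⟩) (.inr ⟨⟩)
  have hinv : (1 + P.toBlocks₂₂) * (1 - P.toBlocks₂₂) = 1 := by
    ext
    simp only [Matrix.mul_apply, Matrix.add_apply, Matrix.sub_apply, Matrix.one_apply_eq,
      Matrix.toBlocks₂₂, Matrix.of_apply, Finset.univ_unique, Finset.sum_singleton]
    linear_combination -hsq
  let _ : Invertible (1 + P.toBlocks₂₂) := invertibleOfRightInverse _ _ hinv
  have schur_eq : 1 + P.toBlocks₁₁ - P.toBlocks₁₂ * (1 - P.toBlocks₂₂) * P.toBlocks₂₁ =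
      1 + (1 + e) • P.toBlocks₁₁ := by
    ext i j
    simp only [Matrix.mul_apply, Matrix.add_apply, Matrix.sub_apply, Matrix.one_apply_eq,
      Matrix.toBlocks₂₂, Matrix.toBlocks₁₁, Matrix.toBlocks₁₂, Matrix.toBlocks₂₁, Matrix.of_apply,
      Finset.univ_unique, Finset.sum_singleton, Matrix.smul_apply, smul_eq_mul]
    linear_combination (e - 1) * hperm (.inr ⟨⟩) (.inr ⟨⟩) (.inl i) (.inl j) -
      P (.inl i) (.inl j) * hsq
  rw [← Matrix.fromBlocks_toBlocks P, ← Matrix.fromBlocks_one, Matrix.fromBlocks_add, zero_add,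
    zero_add, Matrix.det_fromBlocks₂₂, show ⅟(1 + P.toBlocks₂₂) = 1 - P.toBlocks₂₂ from rfl,
    schur_eq, Matrix.det_unique]
  rfl

/- A rank-one matrix `P = u vᵀ` whose components `u i`, `v j` are odd has vanishing `2 × 2`
permanents; for such a matrix the determinant lemma `det (1 + P) = 1 + tr P` is replaced by
`det (1 + P) = (1 - tr P)⁻¹`. -/
theorem det_one_add_mul_one_sub_trace {α : Type*} [Fintype α] [DecidableEq α] (P : Matrix α α C)
    (hperm : ∀ i j i' j', P i j * P i' j' = -(P i j' * P i' j))
    (hcol : ∀ i j i', P i j * P i' j = 0) : (1 + P).det * (1 - P.trace) = 1 := by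
  revert P
  refine Fintype.induction_empty_option (P := fun α _ => ∀ [DecidableEq α] (P : Matrix α α C),
    (∀ i j i' j', P i j * P i' j' = -(P i j' * P i' j)) → (∀ i j i', P i j * P i' j = 0) →
      (1 + P).det * (1 - P.trace) = 1) ?_ ?_ ?_ α
  · intro α β _ e ih _ P hperm hcol
    classical
    let _ := Fintype.ofEquiv β e.symm
    have h := ih (P.submatrix e e) (fun _ _ _ _ => hperm _ _ _ _) (fun _ _ _ => hcol _ _ _)
    have trace_eq : (P.submatrix e e).trace = P.trace := Fintype.sum_equiv e _ _ fun _ => rfl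
    rwa [det_one_add_submatrix, trace_eq] at h
  · intro _ P _ _
    simp [Matrix.trace]
  · intro α _ ih _ P hperm hcol
    classical
    let f := (Equiv.optionEquivSumPUnit.{0} α).symm
    set e := P none none
    have hee : e * e = 0 := hcol _ _ _
    have det_eq : (1 + P).det = (1 + e) * (1 + (1 + e) • P.submatrix some some).det := by
      rw [← det_one_add_submatrix P f]
      exact det_one_add_sum_punit (P.submatrix f f) (fun _ _ _ _ => hperm _ _ _ _) hee
    have trace_eq : P.trace = e + (P.submatrix some some).trace := Fintype.sum_option _
    have h := ih ((1 + e) • P.submatrix some some)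
      (fun i j i' j' => by
        simp only [Matrix.smul_apply, Matrix.submatrix_apply, smul_eq_mul]
        linear_combination (1 + e) ^ 2 * hperm (some i) (some j) (some i') (some j'))
      (fun i j i' => by
        simp only [Matrix.smul_apply, Matrix.submatrix_apply, smul_eq_mul]
        linear_combination (1 + e) ^ 2 * hcol (some i) (some j) (some i'))
    rw [Matrix.trace_smul, smul_eq_mul] at h
    rw [det_eq, trace_eq]
    linear_combination h - (1 + (1 + e) • P.submatrix some some).det * hee

end Determinant

section Berezinian

variable {q k n : ℕ}

theorem leibnizDet_map {A B : Type*} [CommRing A] [Ring B] (f : A →+* B)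
    (M : Matrix (Fin k) (Fin k) A) : leibnizDet (M.map f) = f M.det := by
  rw [leibnizDet, Matrix.det_apply, map_sum]
  refine Finset.sum_congr rfl fun σ _ => ?_
  rw [Units.smul_def, map_zsmul, ← List.prod_ofFn, map_list_prod, List.map_ofFn]
  rfl

/-- The center of the Grassmann algebra. It contains all even elements, so determinants of matrices
with even entries can be computed over this commutative ring. -/
abbrev grassmannCenter (q : ℕ) : Subalgebra ℝ (Grassmann q) := Subalgebra.center ℝ (Grassmann q)

instance : SMulCommClass (grassmannCenter q) (Grassmann q) (Grassmann q) where
  smul_comm d x y := by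
    change d * (x * y) = x * (d * y)
    rw [← mul_assoc, ← mul_assoc, Subalgebra.mem_center_iff.mp d.2 x]

theorem even_mem_center {x : Grassmann q} (hx : x ∈ parityPart q 0) :
    x ∈ grassmannCenter q :=
  Subalgebra.mem_center_iff.mpr fun y => (even_commute hx y).eq.symm

theorem exists_det_one_add_vecMulVec_odd {u r : Fin k → Grassmann q}
    (hu : ∀ i, u i ∈ parityPart q 1) (hr : ∀ i, r i ∈ parityPart q 1) :
    ∃ P : Matrix (Fin k) (Fin k) (grassmannCenter q),
      P.map (grassmannCenter q).val = Matrix.vecMulVec u r ∧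
        (1 + P).det • (1 + r ⬝ᵥ u) = 1 ∧ IsUnit (1 + P).det := by
  let P : Matrix (Fin k) (Fin k) (grassmannCenter q) := Matrix.of fun i j =>
    ⟨u i * r j, even_mem_center (odd_mul_odd (hu i) (hr j))⟩
  have mul_mul_mul_eq (i j i' j') : u i * r j * (u i' * r j') = -(u i * (u i' * (r j * r j'))) := by
    rw [mul_assoc, ← mul_assoc (r j), odd_mul_odd_swap (hr j) (hu i'), neg_mul, mul_neg, mul_assoc]
  have hdet : (1 + P).det * (1 - P.trace) = 1 :=
    det_one_add_mul_one_sub_trace P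
      (fun i j i' j' => Subtype.ext <| by
        change u i * r j * (u i' * r j') = -(u i * r j' * (u i' * r j))
        rw [mul_mul_mul_eq, mul_mul_mul_eq, odd_mul_odd_swap (hr j) (hr j'), mul_neg, mul_neg])
      (fun i j i' => Subtype.ext <| by
        change u i * r j * (u i' * r j) = 0
        rw [mul_mul_mul_eq, odd_mul_self (hr j), mul_zero, mul_zero, neg_zero])
  have trace_eq : (P.trace : Grassmann q) = -(r ⬝ᵥ u) := by
    rw [Matrix.trace, AddSubmonoidClass.coe_finsetSum, dotProduct, ← Finset.sum_neg_distrib]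
    exact Finset.sum_congr rfl fun i _ => odd_mul_odd_swap (hu i) (hr i)
  refine ⟨P, rfl, ?_, .of_mul_eq_one _ hdet⟩
  have h := congrArg (grassmannCenter q).val hdet
  rwa [map_mul, map_sub, map_one, Subalgebra.val_apply, Subalgebra.val_apply, trace_eq,
    sub_neg_eq_add] at h

theorem leibnizDet_and_inverse_add_vecMulVec_odd {J : Matrix (Fin k) (Fin k) ℝ} (hJ : J.det ≠ 0)
    {u r : Fin k → Grassmann q} (hu : ∀ i, u i ∈ parityPart q 1) (hr : ∀ i, r i ∈ parityPart q 1)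
    (hJu : J.map (algebraMap ℝ (Grassmann q)) *ᵥ u = r) :
    ∃ d : grassmannCenter q, d • (1 + r ⬝ᵥ u) = 1 ∧
      leibnizDet (J.map (algebraMap ℝ (Grassmann q)) + Matrix.vecMulVec r r) =
        J.det • (d : Grassmann q) ∧
      Ring.inverse (J.map (algebraMap ℝ (Grassmann q)) + Matrix.vecMulVec r r) *ᵥ r = d • u := by
  obtain ⟨P, map_P, hd, hunit⟩ := exists_det_one_add_vecMulVec_odd hu hr
  set J' := J.map (algebraMap ℝ (Grassmann q))
  have map_eq : (J.map (algebraMap ℝ (grassmannCenter q)) * (1 + P)).map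
      ((grassmannCenter q).val : _ →+* Grassmann q) =
        J' + Matrix.vecMulVec r r := by
    nth_rewrite 1 [← hJu]
    rw [← Matrix.mul_vecMulVec, ← map_P, Matrix.map_mul, Matrix.map_add _ (map_add _),
      Matrix.map_one _ (map_zero _) (map_one _), mul_add, mul_one]
    rfl
  have det_eq : (J.map (algebraMap ℝ (grassmannCenter q)) * (1 + P)).det =
      J.det • (1 + P).det := by
    rw [Matrix.det_mul, ← RingHom.mapMatrix_apply, ← RingHom.map_det, Algebra.smul_def]
  refine ⟨(1 + P).det, hd, ?_, ?_⟩
  · rw [← map_eq, leibnizDet_map, det_eq]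
    rfl
  · have hunit' : IsUnit (J' + Matrix.vecMulVec r r) := by
      rw [← map_eq]
      refine IsUnit.map (RingHom.mapMatrix _) ((Matrix.isUnit_iff_isUnit_det _).mpr ?_)
      rw [det_eq, Algebra.smul_def]
      exact ((IsUnit.mk0 _ hJ).map _).mul hunit
    have hmul : (J' + Matrix.vecMulVec r r) *ᵥ ((1 + P).det • u) = r := by
      rw [Matrix.mulVec_smul, Matrix.add_mulVec, hJu, Matrix.vecMulVec_mulVec]
      ext i
      rw [Pi.smul_apply, Pi.add_apply, Pi.smul_apply, MulOpposite.smul_eq_mul_unop,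
        MulOpposite.unop_op, ← mul_one_add, ← mul_smul_comm, hd, mul_one]
    rw [← hmul, Matrix.mulVec_mulVec, hmul, Ring.inverse_mul_cancel _ hunit', Matrix.one_mulVec]

theorem leibnizDet_one_add_vecMulVec_even (d : grassmannCenter q)
    {p : Fin n → Grassmann q} (hp : ∀ i, p i ∈ parityPart q 0) :
    leibnizDet (1 + d • Matrix.vecMulVec p p) = 1 + d • (p ⬝ᵥ p) := by
  let p' : Fin n → grassmannCenter q := fun i => ⟨p i, even_mem_center (hp i)⟩
  have map_eq : (1 + Matrix.replicateCol Unit (d • p') * Matrix.replicateRow Unit p').map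
      ((grassmannCenter q).val : _ →+* Grassmann q) =
        1 + d • Matrix.vecMulVec p p := by
    rw [Matrix.map_add _ (map_add _), Matrix.map_one _ (map_zero _) (map_one _),
      ← Matrix.vecMulVec_eq]
    congr 1
    ext i j
    exact mul_assoc _ _ _
  rw [← map_eq, leibnizDet_map, Matrix.det_one_add_replicateCol_mul_replicateRow, dotProduct_smul,
    map_add, map_one, smul_eq_mul, map_mul, dotProduct, map_sum]
  rfl

/- The Berezinian of the constant metric with blocks `1` and `J` perturbed by the square of a
covector with even components `p` and odd components `r`: a super version of the matrix
determinant lemma. -/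
theorem berezinian_fromBlocks_add_vecMulVec {J : Matrix (Fin k) (Fin k) ℝ} (hJ : J.det ≠ 0)
    {p : Fin n → Grassmann q} (hp : ∀ i, p i ∈ parityPart q 0)
    {u r : Fin k → Grassmann q} (hu : ∀ i, u i ∈ parityPart q 1) (hr : ∀ i, r i ∈ parityPart q 1)
    (hJu : J.map (algebraMap ℝ (Grassmann q)) *ᵥ u = r) :
    berezinian (Matrix.fromBlocks (1 + Matrix.vecMulVec p p) (Matrix.vecMulVec p r)
      (Matrix.vecMulVec r p) (J.map (algebraMap ℝ (Grassmann q)) + Matrix.vecMulVec r r)) =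
      J.det⁻¹ • (1 + r ⬝ᵥ u + p ⬝ᵥ p) := by
  obtain ⟨d, hd, hdet, hinv⟩ := leibnizDet_and_inverse_add_vecMulVec_odd hJ hu hr hJu
  have smul_eq : d • (r ⬝ᵥ u) = 1 - d • (1 : Grassmann q) :=
    eq_sub_of_add_eq' (by rw [← smul_add, hd])
  have hinvDet : Ring.inverse (J.det • (d : Grassmann q)) = J.det⁻¹ • (1 + r ⬝ᵥ u) := by
    have h : J.det • (d : Grassmann q) * J.det⁻¹ • (1 + r ⬝ᵥ u) = 1 := by
      rw [smul_mul_smul_comm, mul_inv_cancel₀ hJ, one_smul]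
      exact hd
    have h' : J.det⁻¹ • (1 + r ⬝ᵥ u) * J.det • (d : Grassmann q) = 1 := by
      rw [smul_mul_smul_comm, inv_mul_cancel₀ hJ, one_smul, Subalgebra.mem_center_iff.mp d.2]
      exact hd
    exact Ring.inverse_unit ⟨_, _, h, h'⟩
  have schur_eq : 1 + Matrix.vecMulVec p p - Matrix.vecMulVec p r *
      Ring.inverse (J.map (algebraMap ℝ (Grassmann q)) + Matrix.vecMulVec r r) *
        Matrix.vecMulVec r p = 1 + d • Matrix.vecMulVec p p := by
    rw [Matrix.mul_assoc, Matrix.mul_vecMulVec, hinv, Matrix.vecMulVec_mul_vecMulVec,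
      dotProduct_smul, add_sub_assoc]
    congr 1
    ext i j
    simp only [Matrix.sub_apply, Matrix.smul_apply, Matrix.vecMulVec_apply, Pi.smul_apply,
      smul_eq_mul]
    rw [smul_eq, sub_mul, one_mul, smul_mul_assoc, one_mul, mul_sub, mul_smul_comm, sub_sub_cancel]
  rw [berezinian, Matrix.toBlocks_fromBlocks₁₁, Matrix.toBlocks_fromBlocks₁₂,
    Matrix.toBlocks_fromBlocks₂₁, Matrix.toBlocks_fromBlocks₂₂, schur_eq, hdet,
    leibnizDet_one_add_vecMulVec_even d hp, hinvDet, mul_smul_comm, add_mul, one_mul,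
    smul_mul_assoc, ← mul_smul_comm, hd, mul_one]

end Berezinian

/-! ### Taylor evaluation at a nilpotent perturbation -/

section Calculus

variable {𝕜 F : Type*} [NontriviallyNormedField 𝕜] [NormedAddCommGroup F] [NormedSpace 𝕜 F] {a : 𝕜}

theorem contDiffAt_deriv {f : 𝕜 → F} (hf : ContDiffAt 𝕜 ∞ f a) : ContDiffAt 𝕜 ∞ (deriv f) a :=
  (hf.fderiv_right (m := ∞) le_rfl).clm_apply contDiffAt_const

theorem contDiffAt_iteratedDeriv {f : 𝕜 → F} (hf : ContDiffAt 𝕜 ∞ f a) (k : ℕ) :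
    ContDiffAt 𝕜 ∞ (iteratedDeriv k f) a := by
  induction k with
  | zero => rwa [iteratedDeriv_zero]
  | succ k ih => rw [iteratedDeriv_succ]; exact contDiffAt_deriv ih

theorem iteratedDeriv_comp_eq_zero {N : ℕ} {h f : 𝕜 → 𝕜} (hf : ContDiffAt 𝕜 ∞ f a)
    (hh : ContDiffAt 𝕜 ∞ h (f a)) (h_flat : ∀ j < N, iteratedDeriv j h (f a) = 0) :
    ∀ j < N, iteratedDeriv j (h ∘ f) a = 0 := by
  induction N generalizing h with
  | zero => exact fun j hj => absurd hj j.not_lt_zero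
  | succ N ih =>
    rintro (_ | j) hj
    · simpa using h_flat 0 hj
    · have chain_rule : deriv (h ∘ f) =ᶠ[nhds a] (deriv h ∘ f) * deriv f := by
        filter_upwards [(hf.of_le (m := 1) (by simp)).eventually (by simp),
          hf.continuousAt.eventually ((hh.of_le (m := 1) (by simp)).eventually (by simp))]
          with x hfx hhx
        exact deriv_comp x (hhx.differentiableAt one_ne_zero) (hfx.differentiableAt one_ne_zero)
      have hdh := contDiffAt_deriv hh
      rw [iteratedDeriv_succ', chain_rule.iteratedDeriv_eq, iteratedDeriv_mul
        (contDiffAt_infty.mp (hdh.comp a hf) j) (contDiffAt_infty.mp (contDiffAt_deriv hf) j)]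
      refine Finset.sum_eq_zero fun i hi => ?_
      rw [ih hdh (fun l hl => by rw [← iteratedDeriv_succ']; exact h_flat _ (by omega)) i
        (by rw [Finset.mem_range] at hi; omega), mul_zero, zero_mul]

theorem iteratedDeriv_sub_pow (b : 𝕜) (k j : ℕ) :
    iteratedDeriv j (fun t : 𝕜 => (t - b) ^ k) b = if j = k then (k.factorial : 𝕜) else 0 := by
  rw [iteratedDeriv_comp_sub_const j (fun t : 𝕜 => t ^ k)]
  simp only [iteratedDeriv_pow, sub_self]
  rcases lt_trichotomy j k with h | rfl | h
  · rw [if_neg h.ne, zero_pow (by omega), mul_zero]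
  · simp [Nat.descFactorial_self]
  · rw [if_neg h.ne', Nat.descFactorial_eq_zero_iff_lt.mpr h, Nat.cast_zero, zero_mul]

end Calculus

section TaylorEval

variable {A : Type*} [Ring A] [Algebra ℝ A] {N : ℕ} {f g : ℝ → ℝ} {a : ℝ} {z : A}

/-- The Taylor polynomial of `f` at `a` with `N` terms, evaluated at `a + z`. It is the value
`f (a + z)` of the functional calculus of smooth functions when `z ^ N = 0`. -/
def taylorEval (N : ℕ) (f : ℝ → ℝ) (a : ℝ) (z : A) : A :=
  ∑ k ∈ Finset.range N, (iteratedDeriv k f a / (k.factorial : ℝ)) • z ^ k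

theorem taylorEval_congr (h : f =ᶠ[nhds a] g) (z : A) :
    taylorEval N f a z = taylorEval N g a z :=
  Finset.sum_congr rfl fun k _ => by rw [h.iteratedDeriv_eq]

theorem taylorEval_add (hf : ContDiffAt ℝ ∞ f a)
    (hg : ContDiffAt ℝ ∞ g a) (z : A) :
    taylorEval N (f + g) a z = taylorEval N f a z + taylorEval N g a z := by
  rw [taylorEval, taylorEval, taylorEval, ← Finset.sum_add_distrib]
  refine Finset.sum_congr rfl fun k _ => ?_
  rw [iteratedDeriv_add (contDiffAt_infty.mp hf k) (contDiffAt_infty.mp hg k), add_div, add_smul]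

theorem taylorEval_const_mul (c : ℝ) (f : ℝ → ℝ) (a : ℝ) (z : A) :
    taylorEval N (fun t => c * f t) a z = c • taylorEval N f a z := by
  rw [taylorEval, taylorEval, Finset.smul_sum]
  refine Finset.sum_congr rfl fun k _ => ?_
  rw [iteratedDeriv_const_mul_field, mul_div_assoc, mul_smul]

theorem taylorEval_sum {ι : Type*} (s : Finset ι) {f : ι → ℝ → ℝ}
    (hf : ∀ i ∈ s, ContDiffAt ℝ ∞ (f i) a) (z : A) :
    taylorEval N (fun t => ∑ i ∈ s, f i t) a z = ∑ i ∈ s, taylorEval N (f i) a z := by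
  simp only [taylorEval]
  rw [Finset.sum_comm]
  refine Finset.sum_congr rfl fun k _ => ?_
  rw [iteratedDeriv_fun_sum fun i hi => contDiffAt_infty.mp (hf i hi) k, Finset.sum_div,
    Finset.sum_smul]

theorem taylorEval_eq_zero (h : ∀ j < N, iteratedDeriv j f a = 0)
    (z : A) : taylorEval N f a z = 0 :=
  Finset.sum_eq_zero fun k hk => by rw [h k (Finset.mem_range.mp hk), zero_div, zero_smul]

theorem taylorEval_sub_pow (hz : z ^ N = 0) (k : ℕ) :
    taylorEval N (fun t => (t - a) ^ k) a z = z ^ k := by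
  have term_eq (j : ℕ) : (iteratedDeriv j (fun t : ℝ => (t - a) ^ k) a / (j.factorial : ℝ)) •
      z ^ j = if j = k then z ^ k else 0 := by
    rw [iteratedDeriv_sub_pow]
    split_ifs with hj
    · rw [hj, div_self (by exact_mod_cast k.factorial_ne_zero), one_smul]
    · rw [zero_div, zero_smul]
  simp only [taylorEval, term_eq, Finset.sum_ite_eq', Finset.mem_range, ite_eq_left_iff, not_lt]
  exact fun hk => (pow_eq_zero_of_le hk hz).symm

theorem taylorEval_const (c : ℝ) (hz : z ^ N = 0) :
    taylorEval N (fun _ => c) a z = algebraMap ℝ A c := by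
  have h := taylorEval_const_mul (N := N) c (fun t => (t - a) ^ 0) a z
  rw [taylorEval_sub_pow hz, pow_zero, ← Algebra.algebraMap_eq_smul_one] at h
  simpa using h

theorem taylorEval_id (hz : z ^ N = 0) :
    taylorEval N (fun t => t) a z = algebraMap ℝ A a + z := by
  have h := taylorEval_add (N := N) (f := fun _ => a) (g := fun t => (t - a) ^ 1) (a := a)
    contDiffAt_const (by fun_prop) z
  rw [taylorEval_sub_pow hz, taylorEval_const a hz, pow_one] at h
  rw [← h]
  congr 1
  ext t
  simp

theorem taylorEval_mul (hf : ContDiffAt ℝ ∞ f a) (hg : ContDiffAt ℝ ∞ g a) (hz : z ^ N = 0) :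
    taylorEval N (f * g) a z = taylorEval N f a z * taylorEval N g a z := by
  let term (f : ℝ → ℝ) (k : ℕ) : A := (iteratedDeriv k f a / (k.factorial : ℝ)) • z ^ k
  have leibniz (k : ℕ) :
      term (f * g) k = ∑ i ∈ Finset.range (k + 1), term f i * term g (k - i) := by
    simp only [term]
    rw [iteratedDeriv_mul (contDiffAt_infty.mp hf k) (contDiffAt_infty.mp hg k), Finset.sum_div,
      Finset.sum_smul]
    refine Finset.sum_congr rfl fun i hi => ?_
    have hik : i ≤ k := Finset.mem_range_succ_iff.mp hi
    rw [smul_mul_smul_comm, ← pow_add, Nat.add_sub_cancel' hik, Nat.cast_choose ℝ hik]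
    congr 1
    have := Nat.factorial_ne_zero k
    field_simp
  change ∑ k ∈ Finset.range N, term (f * g) k = (∑ i ∈ Finset.range N, term f i) *
    ∑ j ∈ Finset.range N, term g j
  simp only [leibniz]
  rw [Finset.sum_range_diag_flip N fun i j => term f i * term g j, Finset.sum_mul_sum]
  refine Finset.sum_congr rfl fun i _ =>
    Finset.sum_subset (Finset.range_mono (Nat.sub_le _ _)) fun j _ hj => ?_
  rw [Finset.mem_range, not_lt] at hj
  simp only [term]
  rw [smul_mul_smul_comm, ← pow_add, pow_eq_zero_of_le (by omega) hz, smul_zero]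

theorem taylorEval_pow (hf : ContDiffAt ℝ ∞ f a)
    (hz : z ^ N = 0) (k : ℕ) : taylorEval N (f ^ k) a z = taylorEval N f a z ^ k := by
  induction k with
  | zero =>
    rw [pow_zero, pow_zero]
    exact (taylorEval_const 1 hz).trans (map_one _)
  | succ k ih => rw [pow_succ, pow_succ, taylorEval_mul (f := f ^ k) (hf.pow k) hf hz, ih]

theorem taylorEval_sub_const (hf : ContDiffAt ℝ ∞ f a)
    (hz : z ^ N = 0) (c : ℝ) :
    taylorEval N (fun t => f t - c) a z = taylorEval N f a z - algebraMap ℝ A c := by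
  have h := taylorEval_add (N := N) (f := f) (g := fun _ => -c) hf contDiffAt_const z
  rw [taylorEval_const _ hz, map_neg, ← sub_eq_add_neg] at h
  rw [← h]
  congr 1

theorem taylorEval_comp (hf : ContDiffAt ℝ ∞ f a) (hg : ContDiffAt ℝ ∞ g (f a))
    (hz : z ^ N = 0) :
    taylorEval N g (f a) (taylorEval N f a z - algebraMap ℝ A (f a)) =
      taylorEval N (g ∘ f) a z := by
  let c (j : ℕ) : ℝ := iteratedDeriv j g (f a) / (j.factorial : ℝ)
  let P (t : ℝ) : ℝ := ∑ j ∈ Finset.range N, c j * (t - f a) ^ j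
  have hP : ContDiffAt ℝ ∞ P (f a) := by fun_prop
  have hgP : ContDiffAt ℝ ∞ (g - P) (f a) := hg.sub hP
  have sub_P_flat : ∀ j < N, iteratedDeriv j (g - P) (f a) = 0 := fun j hj => by
    rw [iteratedDeriv_sub (contDiffAt_infty.mp hg j) (contDiffAt_infty.mp hP j),
      iteratedDeriv_fun_sum fun i _ => by fun_prop]
    simp only [iteratedDeriv_const_mul_field, iteratedDeriv_sub_pow, mul_ite, mul_zero]
    rw [Finset.sum_ite_eq, if_pos (Finset.mem_range.mpr hj),
      div_mul_cancel₀ _ (by exact_mod_cast j.factorial_ne_zero), sub_self]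
  have taylorEval_P : taylorEval N (P ∘ f) a z =
      taylorEval N g (f a) (taylorEval N f a z - algebraMap ℝ A (f a)) := by
    have hsub : ContDiffAt ℝ ∞ (fun t => f t - f a) a := hf.sub contDiffAt_const
    refine (taylorEval_sum _ (fun j _ => contDiffAt_const.mul (hsub.pow j)) z).trans ?_
    refine Finset.sum_congr rfl fun j _ => ?_
    rw [taylorEval_const_mul, ← taylorEval_sub_const hf hz, ← taylorEval_pow hsub hz]
    rfl
  rw [← taylorEval_P, show g ∘ f = P ∘ f + (g - P) ∘ f by ext t; simp,
    taylorEval_add (hP.comp a hf) (hgP.comp a hf),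
    taylorEval_eq_zero (iteratedDeriv_comp_eq_zero hf hgP sub_P_flat), add_zero]

end TaylorEval

section TaylorEvalGrassmann

variable {q : ℕ} {f g : ℝ → ℝ} {a : ℝ} {z : Grassmann q}

theorem body_taylorEval (N : ℕ) (f : ℝ → ℝ) (a : ℝ) (hz : body z = 0) :
    body (taylorEval (N + 1) f a z) = f a := by
  simp only [taylorEval, body_sum, body_smul, body_pow, hz, zero_pow_eq]
  simp

theorem evalSmooth_taylorEval (hf : ContDiffAt ℝ ∞ f a) (hg : ContDiffAt ℝ ∞ g (f a))
    (hz : z ^ (q + 1) = 0) (hb : body z = 0) :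
    evalSmooth g (taylorEval (q + 1) f a z) = taylorEval (q + 1) (g ∘ f) a z := by
  change taylorEval (q + 1) g (body _) (soul _) = _
  rw [soul, body_taylorEval q f a hb, taylorEval_comp hf hg hz]

theorem even_taylorEval (N : ℕ) (f : ℝ → ℝ) (a : ℝ) (hz : z ∈ parityPart q 0) :
    taylorEval N f a z ∈ parityPart q 0 :=
  sum_mem fun k _ => even_smul _ (even_pow hz k)

theorem oddBerezin_taylorEval_oddSquare (m : ℕ) (f : ℝ → ℝ) (a : ℝ) :
    oddBerezin (taylorEval (2 * m + 1) f a (oddSquare m)) = 2 ^ m * iteratedDeriv m f a := by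
  simp only [taylorEval, oddBerezin_sum, oddBerezin_smul, oddBerezin_oddSquare_pow, mul_ite,
    mul_zero]
  rw [Finset.sum_ite_eq', if_pos (Finset.mem_range.mpr (by omega))]
  have := Nat.factorial_ne_zero m
  field_simp

end TaylorEvalGrassmann

/-! ### The induced metric on a hemisphere -/

section EvenDeriv

variable {n q : ℕ} {f g : (Fin n → ℝ) → Grassmann q} {x : Fin n → ℝ}

theorem coeff_smul (S : Finset (Fin q)) (r : ℝ) (a : Grassmann q) :
    coeff S (r • a) = r * coeff S a := by simp [coeff]

theorem coeff_sum (S : Finset (Fin q)) {ι : Type*} (s : Finset ι) (f : ι → Grassmann q) :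
    coeff S (∑ i ∈ s, f i) = ∑ i ∈ s, coeff S (f i) := by
  simp [coeff, map_sum, Finset.sum_apply']

theorem sum_coeff_smul (a : Grassmann q) :
    ∑ S, coeff S a • (Pi.basisFun ℝ (Fin q)).ExteriorAlgebra S = a :=
  (Pi.basisFun ℝ (Fin q)).ExteriorAlgebra.sum_repr a

theorem evenDeriv_congr (j : Fin n) (h : f =ᶠ[nhds x] g) : evenDeriv j f x = evenDeriv j g x := by
  refine Finset.sum_congr rfl fun S _ => ?_
  have hS : (fun y => coeff S (f y)) =ᶠ[nhds x] fun y => coeff S (g y) := h.fun_comp (coeff S)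
  rw [hS.fderiv_eq]

theorem evenDeriv_sum_smul (j : Fin n) {ι : Type*} (s : Finset ι) {c : ι → (Fin n → ℝ) → ℝ}
    (v : ι → Grassmann q) (hc : ∀ i ∈ s, DifferentiableAt ℝ (c i) x) :
    evenDeriv j (fun y => ∑ i ∈ s, c i y • v i) x =
      ∑ i ∈ s, fderiv ℝ (c i) x (Pi.single j 1) • v i := by
  have fderiv_coeff (S : Finset (Fin q)) :
      fderiv ℝ (fun y => coeff S (∑ i ∈ s, c i y • v i)) x (Pi.single j (1 : ℝ)) =
        ∑ i ∈ s, fderiv ℝ (c i) x (Pi.single j 1) * coeff S (v i) := by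
    simp only [coeff_sum, coeff_smul]
    rw [fderiv_fun_sum fun i hi => (hc i hi).mul_const _, sum_apply]
    refine Finset.sum_congr rfl fun i hi => ?_
    rw [fderiv_mul_const (hc i hi), smul_apply, smul_eq_mul, mul_comm]
  simp only [evenDeriv, fderiv_coeff, Finset.sum_smul, mul_smul]
  rw [Finset.sum_comm]
  refine Finset.sum_congr rfl fun i _ => ?_
  rw [← Finset.smul_sum, sum_coeff_smul]

theorem evenDeriv_smul_add_const (j : Fin n) {c : (Fin n → ℝ) → ℝ} (hc : DifferentiableAt ℝ c x)
    (v w : Grassmann q) :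
    evenDeriv j (fun y => c y • v + w) x = fderiv ℝ c x (Pi.single j 1) • v := by
  have h := evenDeriv_sum_smul j (Finset.univ : Finset (Fin 2)) (c := ![c, fun _ => 1]) ![v, w]
    (x := x) (by intro i _; fin_cases i <;> simp [hc])
  simpa [Fin.sum_univ_two] using h

theorem evenDeriv_mul (j : Fin n) (hf : ∀ S, DifferentiableAt ℝ (fun y => coeff S (f y)) x)
    (hg : ∀ S, DifferentiableAt ℝ (fun y => coeff S (g y)) x) :
    evenDeriv j (fun y => f y * g y) x = evenDeriv j f x * g x + f x * evenDeriv j g x := by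
  set b := (Pi.basisFun ℝ (Fin q)).ExteriorAlgebra with hb
  have mul_eq_sum (a c : Grassmann q) : a * c = ∑ p ∈ (Finset.univ ×ˢ Finset.univ :
      Finset (Finset (Fin q) × Finset (Fin q))),
        (coeff p.1 a * coeff p.2 c) • (b p.1 * b p.2) := by
    rw [Finset.sum_product]
    nth_rewrite 1 [← sum_coeff_smul a, ← sum_coeff_smul c]
    simp only [Finset.sum_mul_sum, smul_mul_smul_comm, ← hb]
  simp only [mul_eq_sum (f _) (g _)]
  rw [evenDeriv_sum_smul j _ _ fun p _ => (hf p.1).mul (hg p.2), Finset.sum_product]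
  conv_rhs => rw [← sum_coeff_smul (f x), ← sum_coeff_smul (g x)]
  rw [evenDeriv, evenDeriv, Finset.sum_mul_sum, Finset.sum_mul_sum, ← Finset.sum_add_distrib]
  refine Finset.sum_congr rfl fun S _ => ?_
  rw [← Finset.sum_add_distrib]
  refine Finset.sum_congr rfl fun T _ => ?_
  rw [smul_mul_smul_comm, smul_mul_smul_comm, ← add_smul, fderiv_fun_mul (hf S) (hg T)]
  congr 1
  simp only [add_apply, smul_apply, smul_eq_mul]
  ring

end EvenDeriv

section OddMetric

variable {m : ℕ}

/-- The odd-odd block of the Euclidean metric. -/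
def oddMetric (m : ℕ) : Matrix (Fin (2 * m)) (Fin (2 * m)) ℝ :=
  (euclideanMetric 0 m).toBlocks₂₂

/-- The numbering `(μ, 0) ↦ ξ^μ`, `(μ, 1) ↦ η^μ` of the odd coordinates by pairs. -/
def oddIdxEquiv (m : ℕ) : Fin m × Fin 2 ≃ Fin (2 * m) :=
  finProdFinEquiv.trans (finCongr (mul_comm m 2))

theorem oddIdxEquiv_zero (μ : Fin m) : oddIdxEquiv m (μ, 0) = xiIdx μ := by
  simp [oddIdxEquiv, xiIdx, finProdFinEquiv]

theorem oddIdxEquiv_one (μ : Fin m) : oddIdxEquiv m (μ, 1) = etaIdx μ := by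
  simp [oddIdxEquiv, etaIdx, finProdFinEquiv, add_comm]

theorem sum_odd {A : Type*} [AddCommMonoid A] (f : Fin (2 * m) → A) :
    ∑ j, f j = ∑ μ : Fin m, (f (xiIdx μ) + f (etaIdx μ)) := by
  rw [← (oddIdxEquiv m).sum_comp, Fintype.sum_prod_type]
  simp only [Fin.sum_univ_two, oddIdxEquiv_zero, oddIdxEquiv_one]

theorem oddMetric_apply_xi (b : Fin (2 * m)) (μ : Fin m) :
    oddMetric m b (xiIdx μ) = if b = etaIdx μ then 1 else 0 := by
  change ∑ ν : Fin m, _ = _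
  rw [Finset.sum_eq_single μ]
  · simp [xiIdx_ne_etaIdx]
  · intro ν _ hν; simp [xiIdx_ne_etaIdx, xiIdx_inj, hν.symm]
  · simp

theorem oddMetric_apply_eta (b : Fin (2 * m)) (μ : Fin m) :
    oddMetric m b (etaIdx μ) = -if b = xiIdx μ then 1 else 0 := by
  change ∑ ν : Fin m, _ = _
  rw [Finset.sum_eq_single μ]
  · simp [(xiIdx_ne_etaIdx _ _).symm]
  · intro ν _ hν; simp [(xiIdx_ne_etaIdx _ _).symm, etaIdx_inj, hν.symm]
  · simp

theorem oddMetric_submatrix (m : ℕ) : (oddMetric m).submatrix (oddIdxEquiv m) (oddIdxEquiv m) =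
    Matrix.kroneckerMap (· * ·) (1 : Matrix (Fin m) (Fin m) ℝ) !![0, -1; 1, 0] := by
  ext ⟨μ, a⟩ ⟨ν, b⟩
  fin_cases a <;> fin_cases b <;>
    simp [oddIdxEquiv_zero, oddIdxEquiv_one, oddMetric_apply_xi, oddMetric_apply_eta, xiIdx_inj,
      etaIdx_inj, xiIdx_ne_etaIdx, (xiIdx_ne_etaIdx _ _).symm, Matrix.one_apply]

theorem det_oddMetric (m : ℕ) : (oddMetric m).det = 1 := by
  rw [← Matrix.det_submatrix_equiv_self (oddIdxEquiv m), oddMetric_submatrix, Matrix.det_kronecker]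
  simp [Matrix.det_fin_two]

theorem oddDeriv_oddSquare (b : Fin (2 * m)) :
    oddDeriv b (oddSquare m) = (2 : ℝ) • ∑ c, oddMetric m b c • theta c := by
  rw [oddSquare, map_smul, map_sum, sum_odd]
  congr 1
  refine Finset.sum_congr rfl fun μ _ => ?_
  rw [oddMetric_apply_xi, oddMetric_apply_eta, oddDeriv_theta_mul, oddDeriv_theta]
  split_ifs <;> simp [sub_eq_add_neg]

theorem sum_oddMetric_theta_mul_theta (m : ℕ) :
    ∑ b, (∑ c, oddMetric m b c • (theta c : Grassmann (2 * m))) * theta b = -oddSquare m := by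
  rw [sum_odd, oddSquare, Finset.smul_sum, ← Finset.sum_neg_distrib]
  refine Finset.sum_congr rfl fun μ _ => ?_
  simp only [sum_odd, oddMetric_apply_xi, oddMetric_apply_eta, xiIdx_inj, etaIdx_inj,
    xiIdx_ne_etaIdx, (xiIdx_ne_etaIdx _ _).symm, if_false, neg_zero, zero_smul, add_zero, zero_add,
    neg_smul, ite_smul, one_smul, Finset.sum_ite_eq, Finset.sum_neg_distrib, Finset.mem_univ,
    if_true]
  rw [odd_mul_odd_swap (odd_theta (xiIdx μ)) (odd_theta _), two_smul, neg_mul, neg_add]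

end OddMetric

section InducedMetric

theorem SuperMap.even_coord {n q N Q : ℕ} (Φ : SuperMap n q N Q) (A : Fin N) {x : Fin n → ℝ}
    (hx : x ∈ Φ.domain) : Φ.coord (.inl A) x ∈ parityPart q 0 := by
  simpa [coordParity] using Φ.parity (.inl A) x hx

theorem SuperMap.inducedMetric_euclideanMetric {n q N m : ℕ} (Φ : SuperMap n q N (2 * m))
    (x : Fin n → ℝ) (a b : Fin n ⊕ Fin q) :
    Φ.inducedMetric (euclideanMetric N m) x a b =
      ∑ A, superDeriv a (Φ.coord (.inl A)) x * superDeriv b (Φ.coord (.inl A)) x +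
      ∑ c, ∑ d, ((-1 : ℝ) ^ (1 + coordParity b) * oddMetric m c d) •
        (superDeriv a (Φ.coord (.inr c)) x * superDeriv b (Φ.coord (.inr d)) x) := by
  simp only [SuperMap.inducedMetric, Matrix.of_apply, Fintype.sum_sum_type, euclideanMetric,
    oddMetric, Matrix.toBlocks_fromBlocks₂₂, Matrix.fromBlocks_apply₁₁, Matrix.fromBlocks_apply₁₂,
    Matrix.fromBlocks_apply₂₁, Matrix.fromBlocks_apply₂₂, Matrix.zero_apply, Matrix.one_apply,
    coordParity, Sum.elim_inl, Sum.elim_inr, mul_zero, zero_smul, Finset.sum_const_zero, add_zero,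
    zero_add, zero_mul, pow_zero, one_mul, ite_smul, one_smul, Finset.sum_ite_eq, Finset.mem_univ,
    if_true]

theorem even_sq_mul_dotProduct {q : ℕ} {ι : Type*} [Fintype ι] {x : Grassmann q}
    (hx : x ∈ parityPart q 0) (v w : ι → Grassmann q) :
    x ^ 2 * (v ⬝ᵥ w) = (x • v) ⬝ᵥ (x • w) := by
  rw [dotProduct, dotProduct, Finset.mul_sum]
  refine Finset.sum_congr rfl fun i _ => ?_
  rw [Pi.smul_apply, Pi.smul_apply, smul_eq_mul, smul_eq_mul, mul_assoc, ← mul_assoc (v i),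
    ← (even_commute hx (v i)).eq, pow_two]
  simp only [mul_assoc]

end InducedMetric

namespace IsHemisphereChart

variable {n m : ℕ} {R : ℝ} {i : Fin (n + 1)} {ε : ℤˣ} {Φ : SuperMap n (2 * m) (n + 1) (2 * m)}
  {y : Fin n → ℝ}

theorem coord_sq (hΦ : IsHemisphereChart R i ε Φ) (hy : y ∈ Φ.domain) :
    Φ.coord (.inl i) y ^ 2 =
      algebraMap ℝ (Grassmann (2 * m)) (R ^ 2 - ∑ j, y j ^ 2) + oddSquare m := by
  have h := hΦ.sphere_eq y hy
  simp only [SuperMap.scalarSquare, Fin.sum_univ_succAbove _ i, hΦ.coord_even y hy,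
    hΦ.coord_odd y hy, odd_mul_odd_swap (odd_theta (xiIdx _)) (odd_theta (etaIdx _)),
    Finset.sum_neg_distrib, smul_neg, ← map_pow, ← map_sum] at h
  rw [map_sub, ← h, oddSquare]
  abel

theorem sq_sub_sum_sq_pos (hΦ : IsHemisphereChart R i ε Φ) (hy : y ∈ Φ.domain) :
    0 < R ^ 2 - ∑ j, y j ^ 2 := by
  rw [hΦ.domain_eq] at hy
  exact sub_pos.mpr hy

theorem body_coord_ne_zero (hΦ : IsHemisphereChart R i ε Φ) (hy : y ∈ Φ.domain) :
    body (Φ.coord (.inl i) y) ≠ 0 :=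
  right_ne_zero_of_mul (hΦ.sign y hy).ne'

theorem coord_mul_evenDeriv (hΦ : IsHemisphereChart R i ε Φ) (hy : y ∈ Φ.domain) (j : Fin n) :
    Φ.coord (.inl i) y * evenDeriv j (Φ.coord (.inl i)) y =
      -algebraMap ℝ (Grassmann (2 * m)) (y j) := by
  have hnhds := Φ.isOpen_domain.mem_nhds hy
  have hdiff (S) : DifferentiableAt ℝ (fun z => coeff S (Φ.coord (.inl i) z)) y :=
    ((Φ.smooth (.inl i) S).contDiffAt hnhds).differentiableAt (by simp)
  have mul_self_eq : (fun z => Φ.coord (.inl i) z * Φ.coord (.inl i) z) =ᶠ[nhds y]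
      fun z => (R ^ 2 - ∑ j, z j ^ 2) • (1 : Grassmann (2 * m)) + oddSquare m := by
    filter_upwards [hnhds] with z hz
    rw [← pow_two, hΦ.coord_sq hz, Algebra.algebraMap_eq_smul_one]
  have hfderiv : HasFDerivAt (fun z : Fin n → ℝ => R ^ 2 - ∑ j, z j ^ 2)
      (-∑ k, (2 * y k) • (ContinuousLinearMap.proj k : (Fin n → ℝ) →L[ℝ] ℝ)) y := by
    refine HasFDerivAt.const_sub (HasFDerivAt.fun_sum fun k _ => ?_) _
    simpa using (hasFDerivAt_apply (𝕜 := ℝ) k y).pow 2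
  have fderiv_eq : fderiv ℝ (fun z : Fin n → ℝ => R ^ 2 - ∑ j, z j ^ 2) y (Pi.single j 1) =
      -(2 * y j) := by
    rw [hfderiv.fderiv]
    simp [sum_apply, Pi.single_apply]
  have h := evenDeriv_mul j hdiff hdiff
  rw [evenDeriv_congr j mul_self_eq, evenDeriv_smul_add_const j hfderiv.differentiableAt,
    fderiv_eq, ← (even_commute (Φ.even_coord i hy) _).eq, ← two_smul ℝ, neg_smul, mul_smul,
    ← smul_neg] at h
  rw [Algebra.algebraMap_eq_smul_one]
  exact (smul_right_injective _ (two_ne_zero (α := ℝ)) h).symm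

theorem coord_mul_oddDeriv (hΦ : IsHemisphereChart R i ε Φ) (hy : y ∈ Φ.domain)
    (b : Fin (2 * m)) :
    Φ.coord (.inl i) y * oddDeriv b (Φ.coord (.inl i) y) = ∑ c, oddMetric m b c • theta c := by
  have hX := Φ.even_coord i hy
  have h := congrArg (oddDeriv b) (hΦ.coord_sq hy)
  rw [pow_two, oddDeriv_even_mul _ hX, ← (even_commute hX _).eq, ← two_smul ℝ, map_add,
    oddDeriv_algebraMap, zero_add, oddDeriv_oddSquare] at h
  exact smul_right_injective _ (two_ne_zero (α := ℝ)) h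

theorem superDeriv_coord_succAbove (hΦ : IsHemisphereChart R i ε Φ) (hy : y ∈ Φ.domain)
    (k : Fin n) (a : Fin n ⊕ Fin (2 * m)) :
    superDeriv a (Φ.coord (.inl (i.succAbove k))) y = if a = .inl k then 1 else 0 := by
  rcases a with j | b
  · have h : Φ.coord (.inl (i.succAbove k)) =ᶠ[nhds y]
        fun z => z k • (1 : Grassmann (2 * m)) + 0 := by
      filter_upwards [Φ.isOpen_domain.mem_nhds hy] with z hz
      rw [hΦ.coord_even z hz, Algebra.algebraMap_eq_smul_one, add_zero]
    rw [superDeriv, Sum.elim_inl, evenDeriv_congr j h,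
      evenDeriv_smul_add_const j (differentiableAt_apply k y), (hasFDerivAt_apply k y).fderiv]
    simp [Pi.single_apply, eq_comm]
  · rw [superDeriv, Sum.elim_inr, hΦ.coord_even y hy, oddDeriv_algebraMap]
    simp

theorem superDeriv_coord_inr (hΦ : IsHemisphereChart R i ε Φ) (hy : y ∈ Φ.domain)
    (c : Fin (2 * m)) (a : Fin n ⊕ Fin (2 * m)) :
    superDeriv a (Φ.coord (.inr c)) y = if a = .inr c then 1 else 0 := by
  rcases a with j | b
  · have h : Φ.coord (.inr c) =ᶠ[nhds y]
        fun _ => (0 : ℝ) • (1 : Grassmann (2 * m)) + theta c := by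
      filter_upwards [Φ.isOpen_domain.mem_nhds hy] with z hz
      rw [hΦ.coord_odd z hz, zero_smul, zero_add]
    rw [superDeriv, Sum.elim_inl, evenDeriv_congr j h,
      evenDeriv_smul_add_const j (differentiableAt_const _)]
    simp
  · rw [superDeriv, Sum.elim_inr, hΦ.coord_odd y hy, oddDeriv_theta]
    simp

theorem inducedMetric_eq (hΦ : IsHemisphereChart R i ε Φ) (hy : y ∈ Φ.domain)
    {p : Fin n → Grassmann (2 * m)} {r : Fin (2 * m) → Grassmann (2 * m)}
    (hp : ∀ j, evenDeriv j (Φ.coord (.inl i)) y = p j)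
    (hr : ∀ b, oddDeriv b (Φ.coord (.inl i) y) = r b) :
    Φ.inducedMetric (euclideanMetric (n + 1) m) y =
      Matrix.fromBlocks (1 + Matrix.vecMulVec p p) (Matrix.vecMulVec p r) (Matrix.vecMulVec r p)
        ((oddMetric m).map (algebraMap ℝ (Grassmann (2 * m))) + Matrix.vecMulVec r r) := by
  ext a b
  rw [SuperMap.inducedMetric_euclideanMetric, Fin.sum_univ_succAbove _ i]
  simp only [hΦ.superDeriv_coord_succAbove hy, hΦ.superDeriv_coord_inr hy]
  rcases a with a | a <;> rcases b with b | b <;>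
    simp [superDeriv, hp, hr, coordParity, Matrix.one_apply, Matrix.vecMulVec_apply, add_comm,
      Algebra.algebraMap_eq_smul_one]

theorem coord_sq_mul_berezinian (hΦ : IsHemisphereChart R i ε Φ) (hy : y ∈ Φ.domain) :
    Φ.coord (.inl i) y ^ 2 * berezinian (Φ.inducedMetric (euclideanMetric (n + 1) m) y) =
      algebraMap ℝ (Grassmann (2 * m)) (R ^ 2) := by
  set X := Φ.coord (.inl i) y
  have hX : X ∈ parityPart (2 * m) 0 := Φ.even_coord i hy
  obtain ⟨Y, hY, hXY⟩ := exists_even_mul_eq_one hX (hΦ.body_coord_ne_zero hy)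
  have eq_Y_mul {a b : Grassmann (2 * m)} (h : X * a = b) : a = Y * b := by
    rw [← h, ← mul_assoc, ← (even_commute hX Y).eq, hXY, one_mul]
  set p : Fin n → Grassmann (2 * m) := fun j => evenDeriv j (Φ.coord (.inl i)) y
  set r : Fin (2 * m) → Grassmann (2 * m) := fun b => oddDeriv b X
  set u : Fin (2 * m) → Grassmann (2 * m) := fun b => Y * theta b
  have hXp : X • p = fun j => -algebraMap ℝ (Grassmann (2 * m)) (y j) :=
    funext (hΦ.coord_mul_evenDeriv hy)
  have hXr : X • r = fun b => ∑ c, oddMetric m b c • theta c := funext (hΦ.coord_mul_oddDeriv hy)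
  have hXu : X • u = theta := funext fun b => by
    rw [Pi.smul_apply, smul_eq_mul, ← mul_assoc, hXY, one_mul]
  have hu (b) : u b ∈ parityPart (2 * m) 1 := even_mul_odd hY (odd_theta b)
  have hp (j) : p j ∈ parityPart (2 * m) 0 := by
    rw [eq_Y_mul (congrFun hXp j)]
    exact even_mul hY (neg_mem (even_algebraMap _))
  have hJu : (oddMetric m).map (algebraMap ℝ (Grassmann (2 * m))) *ᵥ u = r := funext fun b => by
    rw [eq_Y_mul (congrFun hXr b), Finset.mul_sum, Matrix.mulVec, dotProduct]
    refine Finset.sum_congr rfl fun c _ => ?_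
    rw [Matrix.map_apply, ← Algebra.smul_def, mul_smul_comm]
  have hr (b) : r b ∈ parityPart (2 * m) 1 := by
    rw [eq_Y_mul (congrFun hXr b)]
    exact even_mul_odd hY (sum_mem fun c _ => odd_smul _ (odd_theta c))
  rw [hΦ.inducedMetric_eq hy (fun _ => rfl) (fun _ => rfl),
    berezinian_fromBlocks_add_vecMulVec (by simp [det_oddMetric]) hp hu hr hJu, det_oddMetric,
    inv_one, one_smul, mul_add, mul_add, mul_one, even_sq_mul_dotProduct hX,
    even_sq_mul_dotProduct hX, hXp, hXr, hXu, hΦ.coord_sq hy]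
  simp only [dotProduct, sum_oddMetric_theta_mul_theta, ← pow_two, neg_sq, ← map_pow, ← map_sum]
  rw [map_sub]
  abel

end IsHemisphereChart

/-! ### The chart integrand -/

section EvalSmoothMulti

theorem iteratedDeriv_comp_add_smul {N k : ℕ} {f : (Fin N → ℝ) → ℝ} (hf : ContDiff ℝ k f)
    (b v : Fin N → ℝ) (t : ℝ) :
    iteratedDeriv k (fun s : ℝ => f (b + s • v)) t =
      iteratedFDeriv ℝ k f (b + t • v) fun _ => v := by
  have hg : ContDiff ℝ k fun u => f (b + u) := hf.comp (contDiff_const.add contDiff_id)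
  have comp_eq : (fun s : ℝ => f (b + s • v)) =
      (fun u => f (b + u)) ∘ ContinuousLinearMap.toSpanSingleton ℝ v := by
    ext s
    simp
  rw [iteratedDeriv_eq_iteratedFDeriv, comp_eq,
    ContinuousLinearMap.iteratedFDeriv_comp_right _ hg t le_rfl, iteratedFDeriv_comp_add_left]
  simp

theorem insertNth_eq_add_smul {n : ℕ} (i : Fin (n + 1)) (t : ℝ) (y : Fin n → ℝ) :
    (i.insertNth t y : Fin (n + 1) → ℝ) = i.insertNth 0 y + t • Pi.single i (1 : ℝ) := by
  ext A
  refine i.succAboveCases ?_ (fun j => ?_) A <;> simp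

theorem contDiff_insertNth {n : ℕ} (i : Fin (n + 1)) (y : Fin n → ℝ) :
    ContDiff ℝ ∞ fun t : ℝ => (i.insertNth t y : Fin (n + 1) → ℝ) := by
  rw [funext fun t => insertNth_eq_add_smul i t y]
  exact contDiff_const.add (contDiff_id.smul contDiff_const)

theorem evalSmoothMulti_eq_evalSmooth {q n : ℕ} (i : Fin (n + 1)) {f : (Fin (n + 1) → ℝ) → ℝ}
    (hf : ContDiff ℝ ∞ f) {c : Fin (n + 1) → Grassmann q} {y : Fin n → ℝ}
    (hc : ∀ j, c (i.succAbove j) = algebraMap ℝ (Grassmann q) (y j)) :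
    evalSmoothMulti f c = evalSmooth (fun t => f (i.insertNth t y)) (c i) := by
  have body_eq : (fun A => body (c A)) = i.insertNth (body (c i)) y := by
    ext A
    refine i.succAboveCases ?_ (fun j => ?_) A <;> simp [hc, body_algebraMap]
  have soul_eq_zero (A) (hA : A ≠ i) : soul (c A) = 0 := by
    obtain ⟨j, rfl⟩ := Fin.exists_succAbove_eq hA
    rw [hc, soul, body_algebraMap, sub_self]
  rw [evalSmoothMulti, evalSmooth]
  refine Finset.sum_congr rfl fun k _ => ?_
  have deriv_eq : iteratedFDeriv ℝ k f (i.insertNth (body (c i)) y)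
      (fun _ => Pi.single i (1 : ℝ)) =
        iteratedDeriv k (fun t => f (i.insertNth t y)) (body (c i)) := by
    rw [insertNth_eq_add_smul, ← iteratedDeriv_comp_add_smul (contDiff_infty.mp hf k)]
    simp only [← insertNth_eq_add_smul]
  rw [Finset.sum_eq_single (fun _ => i), List.ofFn_const, List.prod_replicate, smul_smul, body_eq,
    deriv_eq, div_eq_inv_mul]
  · intro idx _ hidx
    obtain ⟨l, hl⟩ := Function.ne_iff.mp hidx
    rw [List.prod_eq_zero (List.mem_ofFn.mpr ⟨l, soul_eq_zero _ hl⟩), smul_zero]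
  · simp

end EvalSmoothMulti

section Sign

variable (ε : ℤˣ)

theorem sign_mul_sign_mul (t : ℝ) : ((ε : ℤ) : ℝ) * (((ε : ℤ) : ℝ) * t) = t := by
  rcases Int.units_eq_one_or ε with rfl | rfl <;> simp

theorem sign_mul_sq (t : ℝ) : (((ε : ℤ) : ℝ) * t) ^ 2 = t ^ 2 := by
  rcases Int.units_eq_one_or ε with rfl | rfl <;> simp

theorem contDiffAt_sign_mul_sqrt {a : ℝ} (ha : 0 < a) :
    ContDiffAt ℝ ∞ (fun w => ((ε : ℤ) : ℝ) * √w) a :=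
  contDiffAt_const.mul (Real.contDiffAt_sqrt ha.ne')

theorem taylorEval_sign_mul_sqrt_sq (m : ℕ) {a : ℝ} (ha : 0 < a) :
    taylorEval (2 * m + 1) (fun w => ((ε : ℤ) : ℝ) * √w) a (oddSquare m) ^ 2 =
      algebraMap ℝ (Grassmann (2 * m)) a + oddSquare m := by
  have hz : oddSquare m ^ (2 * m + 1) = 0 := oddSquare_pow_eq_zero (by omega)
  rw [← taylorEval_pow (contDiffAt_sign_mul_sqrt ε ha) hz, ← taylorEval_id hz]
  refine taylorEval_congr ?_ _
  filter_upwards [lt_mem_nhds ha] with w hw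
  rw [Pi.pow_apply, sign_mul_sq, Real.sq_sqrt hw.le]

end Sign

namespace IsHemisphereChart

variable {n m : ℕ} {R : ℝ} {i : Fin (n + 1)} {ε : ℤˣ} {Φ : SuperMap n (2 * m) (n + 1) (2 * m)}
  {y : Fin n → ℝ} {ρ : (Fin (n + 1) → ℝ) → ℝ}

theorem coord_eq_taylorEval (hΦ : IsHemisphereChart R i ε Φ) (hy : y ∈ Φ.domain) :
    Φ.coord (.inl i) y =
      taylorEval (2 * m + 1) (fun w => ((ε : ℤ) : ℝ) * √w) (R ^ 2 - ∑ j, y j ^ 2)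
        (oddSquare m) := by
  have ha := hΦ.sq_sub_sum_sq_pos hy
  refine even_eq_of_sq_eq (Φ.even_coord i hy) (even_taylorEval _ _ _ (even_oddSquare m)) ?_ ?_
  · rw [hΦ.coord_sq hy, taylorEval_sign_mul_sqrt_sq ε m ha]
  · rw [body_taylorEval _ _ _ (body_oddSquare m)]
    refine right_ne_zero_of_mul (a := ((ε : ℤ) : ℝ)) (ne_of_gt ?_)
    rw [mul_add, sign_mul_sign_mul]
    exact add_pos (hΦ.sign y hy) (Real.sqrt_pos.mpr ha)

theorem berezinian_eq_taylorEval (hΦ : IsHemisphereChart R i ε Φ) (hy : y ∈ Φ.domain) :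
    berezinian (Φ.inducedMetric (euclideanMetric (n + 1) m) y) =
      taylorEval (2 * m + 1) (fun w => R ^ 2 / w) (R ^ 2 - ∑ j, y j ^ 2) (oddSquare m) := by
  have ha := hΦ.sq_sub_sum_sq_pos hy
  have hz : oddSquare m ^ (2 * m + 1) = 0 := oddSquare_pow_eq_zero (by omega)
  have hinv : ContDiffAt ℝ ∞ (fun w : ℝ => R ^ 2 / w) (R ^ 2 - ∑ j, y j ^ 2) :=
    contDiffAt_const.div contDiffAt_id ha.ne'
  have hunit : IsUnit (Φ.coord (.inl i) y) :=
    isUnit_of_body_ne_zero (Φ.even_coord i hy) (hΦ.body_coord_ne_zero hy)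
  refine (hunit.pow 2).mul_left_cancel ((hΦ.coord_sq_mul_berezinian hy).trans ?_)
  rw [hΦ.coord_sq hy, ← taylorEval_id hz, ← taylorEval_mul (f := fun t => t) contDiffAt_id
    hinv hz, ← taylorEval_const (R ^ 2) hz]
  refine taylorEval_congr ?_ _
  filter_upwards [lt_mem_nhds ha] with w hw
  rw [Pi.mul_apply, mul_div_cancel₀ _ hw.ne']

theorem volumeDensity_eq_taylorEval (hΦ : IsHemisphereChart R i ε Φ) (hR : 0 < R)
    (hy : y ∈ Φ.domain) :
    Φ.volumeDensity (euclideanMetric (n + 1) m) y =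
      taylorEval (2 * m + 1) (fun w => R / √w) (R ^ 2 - ∑ j, y j ^ 2) (oddSquare m) := by
  have ha := hΦ.sq_sub_sum_sq_pos hy
  have hinv : ContDiffAt ℝ ∞ (fun w : ℝ => R ^ 2 / w) (R ^ 2 - ∑ j, y j ^ 2) :=
    contDiffAt_const.div contDiffAt_id ha.ne'
  rw [SuperMap.volumeDensity, hΦ.berezinian_eq_taylorEval hy, evalSmooth_taylorEval
    hinv (Real.contDiffAt_sqrt (by positivity))
    (oddSquare_pow_eq_zero (by omega)) (body_oddSquare m)]
  refine taylorEval_congr ?_ _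
  filter_upwards with w
  rw [Function.comp_apply, Real.sqrt_div (sq_nonneg R), Real.sqrt_sq hR.le]

theorem pullback_eq_taylorEval (hΦ : IsHemisphereChart R i ε Φ) (hy : y ∈ Φ.domain)
    (hρ : ContDiff ℝ ∞ ρ) :
    Φ.pullback ρ y = taylorEval (2 * m + 1)
      (fun w => ρ (i.insertNth (((ε : ℤ) : ℝ) * √w) y)) (R ^ 2 - ∑ j, y j ^ 2)
        (oddSquare m) := by
  rw [SuperMap.pullback, evalSmoothMulti_eq_evalSmooth i hρ (hΦ.coord_even y hy),
    hΦ.coord_eq_taylorEval hy]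
  exact evalSmooth_taylorEval (contDiffAt_sign_mul_sqrt ε (hΦ.sq_sub_sum_sq_pos hy))
    (hρ.comp (contDiff_insertNth i y)).contDiffAt (oddSquare_pow_eq_zero (by omega))
    (body_oddSquare m)

theorem integrand_eq_iteratedDeriv (hΦ : IsHemisphereChart R i ε Φ) (hR : 0 < R)
    (hy : y ∈ Φ.domain) (hρ : ContDiff ℝ ∞ ρ) :
    Φ.integrand (euclideanMetric (n + 1) m) ρ y = 2 ^ m * R *
      iteratedDeriv m (fun w => ρ (i.insertNth (((ε : ℤ) : ℝ) * √w) y) / √w)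
        (R ^ 2 - ∑ j, y j ^ 2) := by
  have ha := hΦ.sq_sub_sum_sq_pos hy
  have hpullback : ContDiffAt ℝ ∞ (fun w => ρ (i.insertNth (((ε : ℤ) : ℝ) * √w) y))
      (R ^ 2 - ∑ j, y j ^ 2) :=
    (hρ.comp (contDiff_insertNth i y)).contDiffAt.comp _ (contDiffAt_sign_mul_sqrt ε ha)
  have hdensity : ContDiffAt ℝ ∞ (fun w => R / √w) (R ^ 2 - ∑ j, y j ^ 2) :=
    contDiffAt_const.div (Real.contDiffAt_sqrt ha.ne') (Real.sqrt_pos.mpr ha).ne'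
  rw [SuperMap.integrand, hΦ.pullback_eq_taylorEval hy hρ, hΦ.volumeDensity_eq_taylorEval hR hy,
    ← taylorEval_mul hpullback hdensity (oddSquare_pow_eq_zero (by omega)),
    oddBerezin_taylorEval_oddSquare, mul_assoc, ← iteratedDeriv_const_mul_field R]
  congr 2
  funext w
  rw [Pi.mul_apply, mul_div_left_comm]

end IsHemisphereChart

/-! ### Existence of charts and partitions of unity -/

section Existence

theorem superSmoothOn_const {n q : ℕ} (a : Grassmann q) (U : Set (Fin n → ℝ)) :
    SuperSmoothOn (fun _ => a) U := fun _ => contDiffOn_const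

theorem superSmoothOn_algebraMap {n q : ℕ} {g : (Fin n → ℝ) → ℝ} {U : Set (Fin n → ℝ)}
    (hg : ContDiffOn ℝ ∞ g U) :
    SuperSmoothOn (fun y => algebraMap ℝ (Grassmann q) (g y)) U := fun S => by
  simp only [Algebra.algebraMap_eq_smul_one, coeff_smul]
  exact hg.mul contDiffOn_const

theorem superSmoothOn_taylorEval {n q N : ℕ} {f : ℝ → ℝ} {g : (Fin n → ℝ) → ℝ}
    {U : Set (Fin n → ℝ)} (hg : ContDiffOn ℝ ∞ g U) (hf : ∀ y ∈ U, ContDiffAt ℝ ∞ f (g y))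
    (z : Grassmann q) : SuperSmoothOn (fun y => taylorEval N f (g y) z) U := fun S => by
  simp only [taylorEval, coeff_sum, coeff_smul]
  refine ContDiffOn.sum fun k _ => ContDiffOn.mul (ContDiffOn.div_const ?_ _) contDiffOn_const
  exact fun y hy => (contDiffAt_iteratedDeriv (hf y hy) k).comp_contDiffWithinAt y (hg y hy)

/-- The chart of the supersphere over the hemisphere `ε x^i > 0`: the coordinate `x^i` is the
Taylor expansion of `ε √w` about the body `R² - |y|²` of its square. -/
def hemisphereChart (n m : ℕ) (R : ℝ) (i : Fin (n + 1)) (ε : ℤˣ) :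
    SuperMap n (2 * m) (n + 1) (2 * m) where
  domain := {y | ∑ j, y j ^ 2 < R ^ 2}
  isOpen_domain := isOpen_lt (by fun_prop) continuous_const
  coord := Sum.elim (fun A y => i.insertNth (α := fun _ => Grassmann (2 * m))
      (taylorEval (2 * m + 1) (fun w => ((ε : ℤ) : ℝ) * √w) (R ^ 2 - ∑ j, y j ^ 2) (oddSquare m))
      (fun j => algebraMap ℝ (Grassmann (2 * m)) (y j)) A) (fun j _ => theta j)
  smooth := by
    rintro (A | j)
    · refine i.succAboveCases ?_ (fun j => ?_) A
      · simp only [Sum.elim_inl, Fin.insertNth_apply_same]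
        exact superSmoothOn_taylorEval (by fun_prop) (fun y hy =>
          contDiffAt_sign_mul_sqrt ε (sub_pos.mpr hy)) _
      · simp only [Sum.elim_inl, Fin.insertNth_apply_succAbove]
        exact superSmoothOn_algebraMap (by fun_prop)
    · exact superSmoothOn_const _ _
  parity := by
    rintro (A | j) y _
    · simp only [coordParity, Sum.elim_inl, Nat.cast_zero]
      refine i.succAboveCases ?_ (fun j => ?_) A
      · simp only [Fin.insertNth_apply_same]
        exact even_taylorEval _ _ _ (even_oddSquare m)
      · simp only [Fin.insertNth_apply_succAbove]
        exact even_algebraMap _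
    · simp only [coordParity, Sum.elim_inr, Nat.cast_one]
      exact odd_theta j

theorem isHemisphereChart_hemisphereChart (n m : ℕ) (R : ℝ) (i : Fin (n + 1)) (ε : ℤˣ) :
    IsHemisphereChart R i ε (hemisphereChart n m R i ε) where
  domain_eq := rfl
  coord_odd _ _ _ := rfl
  coord_even y _ j := by simp [hemisphereChart]
  sign y hy := by
    simp only [hemisphereChart, Sum.elim_inl, Fin.insertNth_apply_same]
    rw [body_taylorEval _ _ _ (body_oddSquare m), sign_mul_sign_mul]
    exact Real.sqrt_pos.mpr (sub_pos.mpr hy)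
  sphere_eq y hy := by
    rw [SuperMap.scalarSquare, Fin.sum_univ_succAbove _ i]
    simp only [hemisphereChart, Sum.elim_inl, Sum.elim_inr, Fin.insertNth_apply_same,
      Fin.insertNth_apply_succAbove, odd_mul_odd_swap (odd_theta (xiIdx _)) (odd_theta (etaIdx _)),
      Finset.sum_neg_distrib, smul_neg, ← map_pow, ← map_sum]
    rw [taylorEval_sign_mul_sqrt_sq ε m (sub_pos.mpr hy), map_sub, oddSquare]
    abel

theorem exists_isHemispherePartition (n : ℕ) {R : ℝ} (hR : 0 < R) :
    ∃ ρ : Fin (n + 1) × ℤˣ → (Fin (n + 1) → ℝ) → ℝ, IsHemispherePartition R ρ := by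
  have hR2 : 0 < R ^ 2 / 2 := by positivity
  let s : Set (Fin (n + 1) → ℝ) := {x | R ^ 2 / 2 ≤ ∑ i, x i ^ 2}
  let U (α : Fin (n + 1) × ℤˣ) : Set (Fin (n + 1) → ℝ) := {x | 0 < ((α.2 : ℤ) : ℝ) * x α.1}
  have hs : IsClosed s := isClosed_le continuous_const (by fun_prop)
  have hU (α) : IsOpen (U α) := isOpen_lt continuous_const (by fun_prop)
  have hcover : s ⊆ ⋃ α, U α := fun x hx => by
    obtain ⟨i, -, hi⟩ := Finset.exists_ne_zero_of_sum_ne_zero (hR2.trans_le hx).ne'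
    rcases (pow_ne_zero_iff two_ne_zero).mp hi |>.lt_or_gt with h | h
    · exact Set.mem_iUnion.mpr ⟨(i, -1), by simpa [U] using h⟩
    · exact Set.mem_iUnion.mpr ⟨(i, 1), by simpa [U] using h⟩
  obtain ⟨f, hf⟩ := SmoothPartitionOfUnity.exists_isSubordinate
    (modelWithCornersSelf ℝ (Fin (n + 1) → ℝ)) hs U hU hcover
  refine ⟨fun α => f α, fun α => (f α).contMDiff.contDiff, fun α x hx _ => hf α hx,
    fun x hx => ?_⟩
  have hnhds : {z : Fin (n + 1) → ℝ | R ^ 2 / 2 < ∑ i, z i ^ 2} ∈ nhds x :=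
    (isOpen_lt continuous_const (by fun_prop)).mem_nhds (by rw [Set.mem_ofPred_eq, hx]; linarith)
  filter_upwards [hnhds] with z hz
  rw [← finsum_eq_sum_of_fintype]
  exact f.sum_eq_one (le_of_lt hz)

end Existence

/-! ### The distribution of `|x|²` -/

section ParametricIntegral

variable {E F : Type*} [NormedAddCommGroup E] [NormedAddCommGroup F] {k : ℝ × E → F}

theorem integrable_slice [MeasurableSpace E] [BorelSpace E] {μ : Measure E}
    [IsFiniteMeasureOnCompacts μ] (hk : Continuous k) (hc : HasCompactSupport k) (u : ℝ) :
    Integrable (fun y => k (u, y)) μ :=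
  (hk.comp (Continuous.prodMk_right u)).integrable_of_hasCompactSupport
    (HasCompactSupport.of_support_subset_isCompact (hc.isCompact.image continuous_snd)
      fun y hy => ⟨(u, y), subset_tsupport _ hy, rfl⟩)

variable [NormedSpace ℝ E] [NormedSpace ℝ F]

/-- The partial derivative in the real variable of a function on `ℝ × E`. -/
def partialFst (k : ℝ × E → F) (p : ℝ × E) : F := fderiv ℝ k p (1, 0)

theorem contDiff_partialFst (hk : ContDiff ℝ ∞ k) : ContDiff ℝ ∞ (partialFst k) :=
  (hk.fderiv_right (m := ∞) (by simp)).clm_apply contDiff_const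

theorem hasCompactSupport_partialFst (hc : HasCompactSupport k) :
    HasCompactSupport (partialFst k) :=
  (hc.fderiv ℝ).mono fun p hp h => hp (by rw [partialFst, h]; rfl)

theorem hasDerivAt_partialFst (hk : Differentiable ℝ k) (u : ℝ) (y : E) :
    HasDerivAt (fun u => k (u, y)) (partialFst k (u, y)) u :=
  (hk (u, y)).hasFDerivAt.comp_hasDerivAt u ((hasDerivAt_id u).prodMk (hasDerivAt_const u y))

theorem deriv_slice (hk : Differentiable ℝ k) (y : E) :
    deriv (fun u => k (u, y)) = fun u => partialFst k (u, y) :=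
  funext fun u => (hasDerivAt_partialFst hk u y).deriv

variable [MeasurableSpace E] [BorelSpace E] {μ : Measure E} [IsFiniteMeasureOnCompacts μ]

theorem hasDerivAt_integral_slice (hk : ContDiff ℝ ∞ k) (hc : HasCompactSupport k) (u : ℝ) :
    HasDerivAt (fun u => ∫ y, k (u, y) ∂μ) (∫ y, partialFst k (u, y) ∂μ) u := by
  have hd : Continuous (partialFst k) := (contDiff_partialFst hk).continuous
  have hdc : HasCompactSupport (partialFst k) := hasCompactSupport_partialFst hc
  obtain ⟨C, hC⟩ := hdc.exists_bound_of_continuous hd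
  set K : Set E := Prod.snd '' tsupport (partialFst k)
  have hK : IsCompact K := hdc.isCompact.image continuous_snd
  refine (hasDerivAt_integral_of_dominated_loc_of_deriv_le (bound := K.indicator fun _ => C)
    (F' := fun v y => partialFst k (v, y)) Filter.univ_mem
    (.of_forall fun v => (integrable_slice hk.continuous hc v).aestronglyMeasurable)
    (integrable_slice hk.continuous hc u) (integrable_slice hd hdc u).aestronglyMeasurable
    (.of_forall fun y v _ => ?_) ?_
    (.of_forall fun y v _ => hasDerivAt_partialFst (hk.differentiable (by simp)) v y)).2
  · by_cases hy : y ∈ K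
    · rw [Set.indicator_of_mem hy]
      exact hC _
    · rw [Set.indicator_of_notMem hy, image_eq_zero_of_notMem_tsupport fun h => hy ⟨(v, y), h, rfl⟩,
        norm_zero]
  · exact (integrable_indicator_iff hK.isClosed.measurableSet).mpr
      (integrableOn_const hK.measure_lt_top.ne)

theorem deriv_integral_slice (hk : ContDiff ℝ ∞ k) (hc : HasCompactSupport k) :
    deriv (fun u => ∫ y, k (u, y) ∂μ) = fun u => ∫ y, partialFst k (u, y) ∂μ :=
  funext fun u => (hasDerivAt_integral_slice hk hc u).deriv

theorem contDiff_integral_slice (hk : ContDiff ℝ ∞ k) (hc : HasCompactSupport k) :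
    ContDiff ℝ ∞ fun u => ∫ y, k (u, y) ∂μ := by
  rw [contDiff_infty]
  intro m
  induction m generalizing k with
  | zero =>
    rw [Nat.cast_zero, contDiff_zero, continuous_iff_continuousAt]
    exact fun u => (hasDerivAt_integral_slice hk hc u).continuousAt
  | succ m ih =>
    rw [Nat.cast_add, Nat.cast_one, contDiff_succ_iff_deriv, deriv_integral_slice hk hc]
    exact ⟨fun u => (hasDerivAt_integral_slice hk hc u).differentiableAt, by simp,
      ih (contDiff_partialFst hk) (hasCompactSupport_partialFst hc)⟩

theorem integrable_iteratedDeriv_slice (m : ℕ) (hk : ContDiff ℝ ∞ k) (hc : HasCompactSupport k)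
    (u : ℝ) : Integrable (fun y => iteratedDeriv m (fun u => k (u, y)) u) μ := by
  induction m generalizing k with
  | zero => simpa only [iteratedDeriv_zero] using integrable_slice hk.continuous hc u
  | succ m ih =>
    simp only [iteratedDeriv_succ', deriv_slice (hk.differentiable (by simp))]
    exact ih (contDiff_partialFst hk) (hasCompactSupport_partialFst hc)

theorem iteratedDeriv_integral_slice (m : ℕ) (hk : ContDiff ℝ ∞ k) (hc : HasCompactSupport k)
    (u : ℝ) : iteratedDeriv m (fun u => ∫ y, k (u, y) ∂μ) u =
      ∫ y, iteratedDeriv m (fun u => k (u, y)) u ∂μ := by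
  induction m generalizing k with
  | zero => simp only [iteratedDeriv_zero]
  | succ m ih =>
    simp only [iteratedDeriv_succ', deriv_integral_slice hk hc,
      deriv_slice (hk.differentiable (by simp))]
    exact ih (contDiff_partialFst hk) (hasCompactSupport_partialFst hc)

end ParametricIntegral

section SumSq

theorem isProperMap_sum_sq (N : ℕ) : IsProperMap fun x : Fin N → ℝ => ∑ i, x i ^ 2 := by
  have hcont : Continuous fun x : Fin N → ℝ => ∑ i, x i ^ 2 := by fun_prop
  refine isProperMap_iff_isCompact_preimage.mpr ⟨hcont, fun K hK => ?_⟩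
  obtain ⟨b, hb⟩ := hK.bddAbove
  refine Metric.isCompact_of_isClosed_isBounded (hK.isClosed.preimage hcont)
    ((Metric.isBounded_closedBall (x := (0 : Fin N → ℝ)) (r := √b)).subset fun x hx => ?_)
  rw [mem_closedBall_zero_iff, pi_norm_le_iff_of_nonneg (Real.sqrt_nonneg _)]
  exact fun i => Real.abs_le_sqrt ((Finset.single_le_sum (f := fun i => x i ^ 2)
    (fun _ _ => sq_nonneg _) (Finset.mem_univ i)).trans (hb hx))

theorem measurableSet_sum_sq_mem {N : ℕ} {B : Set ℝ} (hB : MeasurableSet B) :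
    MeasurableSet {x : Fin N → ℝ | ∑ i, x i ^ 2 ∈ B} :=
  hB.preimage (isProperMap_sum_sq N).continuous.measurable

theorem volume_real_sum_sq_le (n : ℕ) {b : ℝ} (hb : 0 ≤ b) :
    volume.real {x : Fin (n + 1) → ℝ | ∑ i, x i ^ 2 ≤ b} =
      b ^ (((n : ℝ) + 1) / 2) *
        (Real.pi ^ (((n : ℝ) + 1) / 2) / Real.Gamma (((n : ℝ) + 1) / 2 + 1)) := by
  have preimage_ball : {x : Fin (n + 1) → ℝ | ∑ i, x i ^ 2 ≤ b} =
      (WithLp.toLp 2) ⁻¹' Metric.closedBall (0 : EuclideanSpace ℝ (Fin (n + 1))) √b := by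
    ext x
    simp [EuclideanSpace.norm_eq, Real.sqrt_le_sqrt_iff hb]
  rw [Measure.real, preimage_ball, (PiLp.volume_preserving_toLp (Fin (n + 1))).measure_preimage
    Metric.isClosed_closedBall.measurableSet.nullMeasurableSet, EuclideanSpace.volume_closedBall,
    ENNReal.toReal_mul, ENNReal.toReal_pow, ENNReal.toReal_ofReal (Real.sqrt_nonneg _),
    Fintype.card_fin, Nat.cast_succ, ENNReal.toReal_ofReal (by positivity),
    Real.rpow_div_two_eq_sqrt _ hb, Real.rpow_div_two_eq_sqrt _ Real.pi_pos.le]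
  norm_cast

theorem volume_real_sum_sq_mem_Ioc (n : ℕ) {a b : ℝ} (ha : 0 ≤ a) (hab : a ≤ b) :
    volume.real {x : Fin (n + 1) → ℝ | ∑ i, x i ^ 2 ∈ Set.Ioc a b} =
      (b ^ (((n : ℝ) + 1) / 2) - a ^ (((n : ℝ) + 1) / 2)) *
        (Real.pi ^ (((n : ℝ) + 1) / 2) / Real.Gamma (((n : ℝ) + 1) / 2 + 1)) := by
  have diff_eq : {x : Fin (n + 1) → ℝ | ∑ i, x i ^ 2 ∈ Set.Ioc a b} =
      {x | ∑ i, x i ^ 2 ≤ b} \ {x | ∑ i, x i ^ 2 ≤ a} := by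
    ext x
    simp [and_comm]
  have hfin : volume {x : Fin (n + 1) → ℝ | ∑ i, x i ^ 2 ≤ b} < ⊤ := by
    refine (measure_mono fun x hx => ?_).trans_lt ((isProperMap_sum_sq (n + 1)).isCompact_preimage
      (isCompact_Icc (a := 0) (b := b))).measure_lt_top
    exact ⟨Finset.sum_nonneg fun _ _ => sq_nonneg _, hx⟩
  have hsub : {x : Fin (n + 1) → ℝ | ∑ i, x i ^ 2 ≤ a} ⊆ {x | ∑ i, x i ^ 2 ≤ b} :=
    fun x hx => le_trans hx hab
  rw [diff_eq, measureReal_sdiff hsub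
    (measurableSet_le (by fun_prop) measurable_const) hfin.ne, volume_real_sum_sq_le n ha,
    volume_real_sum_sq_le n (ha.trans hab), sub_mul]

variable {n : ℕ} (i : Fin (n + 1))

theorem sum_insertNth_sq (t : ℝ) (y : Fin n → ℝ) :
    ∑ A, (i.insertNth t y : Fin (n + 1) → ℝ) A ^ 2 = t ^ 2 + ∑ j, y j ^ 2 := by
  rw [Fin.sum_univ_succAbove _ i]
  simp only [Fin.insertNth_apply_same, Fin.insertNth_apply_succAbove]

theorem integral_integral_insertNth {g : (Fin (n + 1) → ℝ) → ℝ} (hg : Integrable g) :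
    ∫ y : Fin n → ℝ, ∫ t : ℝ, g (i.insertNth t y) = ∫ x, g x := by
  have hmp := (volume_preserving_piFinSuccAbove (fun _ : Fin (n + 1) => ℝ) i).symm
  rw [← hmp.integral_comp (MeasurableEquiv.measurableEmbedding _)]
  exact (integral_prod_symm _ (hmp.integrable_comp_of_integrable hg)).symm

end SumSq

section Hemisphere

/-- The density of the pushforward of `2 σ(x) dx` under `x ↦ (y, w)`, where `x = (y, ε √w)` and `y`
collects the coordinates `x^j` with `j ≠ i`. Since `√w = 0` for `w ≤ 0` and division by zero yields
zero, it vanishes there. -/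
def hemisphereKernel {n : ℕ} (i : Fin (n + 1)) (ε : ℤˣ) (σ : (Fin (n + 1) → ℝ) → ℝ)
    (y : Fin n → ℝ) (w : ℝ) : ℝ := σ (i.insertNth (((ε : ℤ) : ℝ) * √w) y) / √w

/-- The density at `u` of the pushforward of `2 σ(x) dx` under `x ↦ |x|²`, for a function `σ`
supported in the half space `ε x^i > 0`. -/
def hemisphereIntegral {n : ℕ} (i : Fin (n + 1)) (ε : ℤˣ) (σ : (Fin (n + 1) → ℝ) → ℝ) (u : ℝ) : ℝ :=
  ∫ y : Fin n → ℝ, hemisphereKernel i ε σ y (u - ∑ j, y j ^ 2)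

variable {n : ℕ} {i : Fin (n + 1)} {ε : ℤˣ} {σ : (Fin (n + 1) → ℝ) → ℝ}

theorem hemisphereKernel_of_nonpos (y : Fin n → ℝ) {w : ℝ} (hw : w ≤ 0) :
    hemisphereKernel i ε σ y w = 0 := by
  rw [hemisphereKernel, Real.sqrt_eq_zero'.mpr hw, div_zero]

theorem hemisphereKernel_indicator (B : Set ℝ) (y : Fin n → ℝ) (u : ℝ) :
    hemisphereKernel i ε ({x | ∑ A, x A ^ 2 ∈ B}.indicator σ) y (u - ∑ j, y j ^ 2) =
      B.indicator (fun u => hemisphereKernel i ε σ y (u - ∑ j, y j ^ 2)) u := by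
  classical
  rcases le_or_gt (u - ∑ j, y j ^ 2) 0 with hw | hw
  · rw [hemisphereKernel_of_nonpos y hw, Set.indicator_apply, hemisphereKernel_of_nonpos y hw,
      ite_self]
  · simp only [hemisphereKernel, Set.indicator_apply, Set.mem_ofPred_eq, sum_insertNth_sq,
      sign_mul_sq, Real.sq_sqrt hw.le, sub_add_cancel, ite_div, zero_div]

theorem integral_hemisphereKernel (hσ : ∀ x, ((ε : ℤ) : ℝ) * x i ≤ 0 → σ x = 0) (y : Fin n → ℝ) :
    ∫ w, hemisphereKernel i ε σ y w = 2 * ∫ t : ℝ, σ (i.insertNth t y) := by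
  set f : ℝ → ℝ := fun t => σ (i.insertNth t y) with hf
  calc
    ∫ w, hemisphereKernel i ε σ y w = ∫ w in Set.Ioi 0, hemisphereKernel i ε σ y w :=
      (setIntegral_eq_integral_of_forall_compl_eq_zero fun w hw =>
        hemisphereKernel_of_nonpos y (not_lt.mp hw)).symm
    _ = ∫ t in Set.Ioi 0, 2 * f (((ε : ℤ) : ℝ) * t) := by
      rw [← integral_comp_rpow_Ioi_of_pos two_pos]
      refine setIntegral_congr_fun measurableSet_Ioi fun t (ht : 0 < t) => ?_
      simp only [hemisphereKernel, hf, Real.rpow_two, Real.sqrt_sq ht.le, smul_eq_mul]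
      rw [show (2 : ℝ) - 1 = 1 by norm_num, Real.rpow_one]
      field_simp
    _ = ∫ t, 2 * f (((ε : ℤ) : ℝ) * t) := by
      refine setIntegral_eq_integral_of_forall_compl_eq_zero fun t ht => ?_
      refine mul_eq_zero_of_right 2 (hσ _ ?_)
      rw [Fin.insertNth_apply_same, sign_mul_sign_mul]
      exact not_lt.mp ht
    _ = 2 * ∫ t, f t := by
      rw [integral_const_mul]
      rcases Int.units_eq_one_or ε with rfl | rfl
      · simp
      · simpa using integral_neg_eq_self f volume

theorem exists_pos_hemisphereKernel_eq_zero (hc : HasCompactSupport σ)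
    (hpos : ∀ x ∈ tsupport σ, 0 < ((ε : ℤ) : ℝ) * x i) :
    ∃ δ > 0, ∀ (y : Fin n → ℝ), ∀ w < δ, hemisphereKernel i ε σ y w = 0 := by
  obtain ⟨δ, hδ, hmin⟩ : ∃ δ > 0, ∀ x ∈ tsupport σ, δ ≤ ((ε : ℤ) : ℝ) * x i := by
    rcases (tsupport σ).eq_empty_or_nonempty with h | h
    · exact ⟨1, one_pos, by simp [h]⟩
    · obtain ⟨x₀, hx₀, hmin⟩ := hc.isCompact.exists_isMinOn h
        (f := fun x : Fin (n + 1) → ℝ => ((ε : ℤ) : ℝ) * x i) (by fun_prop)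
      exact ⟨_, hpos x₀ hx₀, fun x hx => hmin hx⟩
  refine ⟨δ ^ 2, by positivity, fun y w hw => ?_⟩
  have hout : i.insertNth (((ε : ℤ) : ℝ) * √w) y ∉ tsupport σ := fun h => by
    have hle := hmin _ h
    rw [Fin.insertNth_apply_same, sign_mul_sign_mul] at hle
    exact ((Real.sqrt_lt' hδ).mpr hw).not_ge hle
  rw [hemisphereKernel, image_eq_zero_of_notMem_tsupport hout, zero_div]

theorem contDiff_hemisphereKernel (hσ : ContDiff ℝ ∞ σ) (hc : HasCompactSupport σ)
    (hpos : ∀ x ∈ tsupport σ, 0 < ((ε : ℤ) : ℝ) * x i) :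
    ContDiff ℝ ∞ fun p : (Fin n → ℝ) × ℝ => hemisphereKernel i ε σ p.1 p.2 := by
  obtain ⟨δ, hδ, h0⟩ := exists_pos_hemisphereKernel_eq_zero hc hpos
  rw [contDiff_iff_contDiffAt]
  rintro ⟨y, w⟩
  rcases lt_or_ge 0 w with hw | hw
  · have hs : ContDiffAt ℝ ∞ (fun p : (Fin n → ℝ) × ℝ => √p.2) (y, w) :=
      (Real.contDiffAt_sqrt hw.ne').comp (y, w) contDiffAt_snd
    refine ContDiffAt.div (hσ.contDiffAt.comp (y, w) (contDiffAt_pi.mpr fun A => ?_)) hs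
      (Real.sqrt_pos.mpr hw).ne'
    refine i.succAboveCases ?_ (fun j => ?_) A
    · simpa only [Fin.insertNth_apply_same] using contDiffAt_const.mul hs
    · simp only [Fin.insertNth_apply_succAbove]
      fun_prop
  · refine contDiffAt_const (c := (0 : ℝ)) |>.congr_of_eventuallyEq ?_
    filter_upwards [continuousAt_snd.eventually_lt_const (hw.trans_lt hδ)] with p hp
    exact h0 p.1 p.2 hp

theorem contDiff_hemisphereKernel_sub (hσ : ContDiff ℝ ∞ σ) (hc : HasCompactSupport σ)
    (hpos : ∀ x ∈ tsupport σ, 0 < ((ε : ℤ) : ℝ) * x i) :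
    ContDiff ℝ ∞ fun p : ℝ × (Fin n → ℝ) => hemisphereKernel i ε σ p.2 (p.1 - ∑ j, p.2 j ^ 2) :=
  (contDiff_hemisphereKernel hσ hc hpos).comp
    (by fun_prop : ContDiff ℝ ∞ fun p : ℝ × (Fin n → ℝ) => (p.2, p.1 - ∑ j, p.2 j ^ 2))

theorem hasCompactSupport_hemisphereKernel_sub (hc : HasCompactSupport σ) :
    HasCompactSupport fun p : ℝ × (Fin n → ℝ) =>
      hemisphereKernel i ε σ p.2 (p.1 - ∑ j, p.2 j ^ 2) := by
  refine HasCompactSupport.of_support_subset_isCompact (hc.isCompact.image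
    (by fun_prop : Continuous fun x : Fin (n + 1) → ℝ =>
      (∑ A, x A ^ 2, fun j => x (i.succAbove j)))) ?_
  rintro ⟨u, y⟩ hp
  have hw : 0 < u - ∑ j, y j ^ 2 := by
    by_contra h
    exact hp (hemisphereKernel_of_nonpos y (not_lt.mp h))
  refine ⟨i.insertNth (((ε : ℤ) : ℝ) * √(u - ∑ j, y j ^ 2)) y,
    subset_tsupport _ (div_ne_zero_iff.mp hp).1, ?_⟩
  rw [Prod.mk.injEq, sum_insertNth_sq, sign_mul_sq, Real.sq_sqrt hw.le]
  exact ⟨sub_add_cancel _ _, by simp only [Fin.insertNth_apply_succAbove]⟩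

theorem iteratedDeriv_hemisphereKernel_of_nonpos (hc : HasCompactSupport σ)
    (hpos : ∀ x ∈ tsupport σ, 0 < ((ε : ℤ) : ℝ) * x i) (m : ℕ) (y : Fin n → ℝ) {w : ℝ}
    (hw : w ≤ 0) : iteratedDeriv m (hemisphereKernel i ε σ y) w = 0 := by
  obtain ⟨δ, hδ, h0⟩ := exists_pos_hemisphereKernel_eq_zero hc hpos
  have eventually_zero : hemisphereKernel i ε σ y =ᶠ[nhds w] fun _ => 0 := by
    filter_upwards [gt_mem_nhds (hw.trans_lt hδ)] with v hv using h0 y v hv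
  rw [eventually_zero.iteratedDeriv_eq, iteratedDeriv_fun_const_zero]

theorem contDiff_hemisphereIntegral (hσ : ContDiff ℝ ∞ σ) (hc : HasCompactSupport σ)
    (hpos : ∀ x ∈ tsupport σ, 0 < ((ε : ℤ) : ℝ) * x i) : ContDiff ℝ ∞ (hemisphereIntegral i ε σ) :=
  contDiff_integral_slice (contDiff_hemisphereKernel_sub hσ hc hpos)
    (hasCompactSupport_hemisphereKernel_sub hc)

theorem integrable_iteratedDeriv_hemisphereKernel (m : ℕ) (hσ : ContDiff ℝ ∞ σ)
    (hc : HasCompactSupport σ) (hpos : ∀ x ∈ tsupport σ, 0 < ((ε : ℤ) : ℝ) * x i) (u : ℝ) :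
    Integrable fun y : Fin n → ℝ =>
      iteratedDeriv m (hemisphereKernel i ε σ y) (u - ∑ j, y j ^ 2) := by
  have h := integrable_iteratedDeriv_slice (μ := volume) m
    (contDiff_hemisphereKernel_sub hσ hc hpos) (hasCompactSupport_hemisphereKernel_sub hc) u
  simpa only [iteratedDeriv_comp_sub_const] using h

theorem iteratedDeriv_hemisphereIntegral (m : ℕ) (hσ : ContDiff ℝ ∞ σ) (hc : HasCompactSupport σ)
    (hpos : ∀ x ∈ tsupport σ, 0 < ((ε : ℤ) : ℝ) * x i) (u : ℝ) :
    iteratedDeriv m (hemisphereIntegral i ε σ) u =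
      ∫ y : Fin n → ℝ, iteratedDeriv m (hemisphereKernel i ε σ y) (u - ∑ j, y j ^ 2) := by
  have h := iteratedDeriv_integral_slice (μ := volume) m
    (contDiff_hemisphereKernel_sub hσ hc hpos) (hasCompactSupport_hemisphereKernel_sub hc) u
  simp only [iteratedDeriv_comp_sub_const] at h
  exact h

theorem integrable_hemisphereKernel_sub (hσ : ContDiff ℝ ∞ σ) (hc : HasCompactSupport σ)
    (hpos : ∀ x ∈ tsupport σ, 0 < ((ε : ℤ) : ℝ) * x i) :
    Integrable (fun p : ℝ × (Fin n → ℝ) => hemisphereKernel i ε σ p.2 (p.1 - ∑ j, p.2 j ^ 2))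
      (volume.prod volume) :=
  (contDiff_hemisphereKernel_sub hσ hc hpos).continuous.integrable_of_hasCompactSupport
    (hasCompactSupport_hemisphereKernel_sub hc)

theorem integrable_hemisphereIntegral (hσ : ContDiff ℝ ∞ σ) (hc : HasCompactSupport σ)
    (hpos : ∀ x ∈ tsupport σ, 0 < ((ε : ℤ) : ℝ) * x i) : Integrable (hemisphereIntegral i ε σ) :=
  (integrable_hemisphereKernel_sub hσ hc hpos).integral_prod_left

theorem setIntegral_hemisphereIntegral (hσ : ContDiff ℝ ∞ σ) (hc : HasCompactSupport σ)
    (hpos : ∀ x ∈ tsupport σ, 0 < ((ε : ℤ) : ℝ) * x i) {B : Set ℝ} (hB : MeasurableSet B) :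
    ∫ u in B, hemisphereIntegral i ε σ u = 2 * ∫ x in {x | ∑ A, x A ^ 2 ∈ B}, σ x := by
  set S : Set (Fin (n + 1) → ℝ) := {x | ∑ A, x A ^ 2 ∈ B}
  have hS : MeasurableSet S := measurableSet_sum_sq_mem hB
  have hS_zero (x : Fin (n + 1) → ℝ) (hx : ((ε : ℤ) : ℝ) * x i ≤ 0) : S.indicator σ x = 0 :=
    Set.indicator_apply_eq_zero.mpr fun _ =>
      image_eq_zero_of_notMem_tsupport fun h => (hpos x h).not_ge hx
  have hkernel : Integrable (fun p : ℝ × (Fin n → ℝ) =>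
      hemisphereKernel i ε σ p.2 (p.1 - ∑ j, p.2 j ^ 2)) ((volume.restrict B).prod volume) := by
    have h := (integrable_hemisphereKernel_sub hσ hc hpos).restrict (s := B ×ˢ Set.univ)
    rwa [← Measure.prod_restrict, Measure.restrict_univ] at h
  calc
    ∫ u in B, hemisphereIntegral i ε σ u
      = ∫ y : Fin n → ℝ, ∫ u in B, hemisphereKernel i ε σ y (u - ∑ j, y j ^ 2) :=
      integral_integral_swap hkernel
    _ = ∫ y : Fin n → ℝ, ∫ w, hemisphereKernel i ε (S.indicator σ) y w := by
      refine integral_congr_ae (.of_forall fun y => ?_)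
      simp only [← integral_indicator hB, ← hemisphereKernel_indicator]
      exact integral_sub_right_eq_self (fun w => hemisphereKernel i ε (S.indicator σ) y w) _
    _ = 2 * ∫ y : Fin n → ℝ, ∫ t : ℝ, S.indicator σ (i.insertNth t y) := by
      simp only [integral_hemisphereKernel hS_zero, integral_const_mul]
    _ = 2 * ∫ x in S, σ x := by
      rw [integral_integral_insertNth i
        ((hσ.continuous.integrable_of_hasCompactSupport hc).indicator hS), integral_indicator hS]

end Hemisphere

/-! ### The total volume -/

section Cutoff

theorem IsHemispherePartition.eventually_nhds {n : ℕ} {R : ℝ}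
    {ρ : Fin (n + 1) × ℤˣ → (Fin (n + 1) → ℝ) → ℝ} (hρ : IsHemispherePartition R ρ) :
    ∀ᶠ u in nhds (R ^ 2), ∀ x, ∑ i, x i ^ 2 = u →
      (∀ α, x ∈ tsupport (ρ α) → 0 < ((α.2 : ℤ) : ℝ) * x α.1) ∧ ∑ α, ρ α x = 1 := by
  refine (isProperMap_sum_sq (n + 1)).isClosedMap.eventually_nhds_fiber (R ^ 2) fun x hx =>
    (Filter.eventually_all.mpr fun α => ?_).and (hρ.sum_eq_one x hx)
  by_cases hxα : x ∈ tsupport (ρ α)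
  · have hcont : Continuous fun z : Fin (n + 1) → ℝ => ((α.2 : ℤ) : ℝ) * z α.1 := by fun_prop
    filter_upwards [hcont.continuousAt.eventually (lt_mem_nhds (hρ.support α x hxα hx))] with z hz _
    exact hz
  · filter_upwards [(isClosed_tsupport _).isOpen_compl.mem_nhds hxα] with z hz h
    exact absurd h hz

theorem IsHemispherePartition.exists_cutoff {n : ℕ} {R : ℝ}
    {ρ : Fin (n + 1) × ℤˣ → (Fin (n + 1) → ℝ) → ℝ} (hρ : IsHemispherePartition R ρ) :
    ∃ σ : Fin (n + 1) × ℤˣ → (Fin (n + 1) → ℝ) → ℝ, (∀ α, ContDiff ℝ ∞ (σ α)) ∧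
      (∀ α, HasCompactSupport (σ α)) ∧
      (∀ α, ∀ x ∈ tsupport (σ α), 0 < ((α.2 : ℤ) : ℝ) * x α.1) ∧
      ∀ᶠ u in nhds (R ^ 2), ∀ x, ∑ i, x i ^ 2 = u →
        (∀ α, σ α x = ρ α x) ∧ ∑ α, σ α x = 1 := by
  obtain ⟨δ, hδ, hball⟩ := Metric.nhds_basis_closedBall.mem_iff.mp hρ.eventually_nhds
  let χ : ContDiffBump (R ^ 2) := ⟨δ / 2, δ, half_pos hδ, half_lt_self hδ⟩
  let q (x : Fin (n + 1) → ℝ) : ℝ := ∑ i, x i ^ 2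
  have hq : ContDiff ℝ ∞ q := by fun_prop
  have hχ : tsupport (χ ∘ q) ⊆ q ⁻¹' Metric.closedBall (R ^ 2) δ :=
    (tsupport_comp_subset_preimage χ hq.continuous).trans_eq (by rw [χ.tsupport_eq])
  have hχc : HasCompactSupport (χ ∘ q) := HasCompactSupport.of_support_subset_isCompact
    ((isProperMap_sum_sq (n + 1)).isCompact_preimage (isCompact_closedBall (R ^ 2) δ))
    ((subset_tsupport _).trans hχ)
  refine ⟨fun α => (χ ∘ q) * ρ α, fun α => (χ.contDiff.comp hq).mul (hρ.smooth α),
    fun α => hχc.mul_right, fun α x hx => ?_, ?_⟩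
  · exact (hball (hχ (tsupport_mul_subset_left hx)) x rfl).1 α (tsupport_mul_subset_right hx)
  · filter_upwards [χ.eventuallyEq_one, hρ.eventually_nhds] with u hu hgood x hx
    have heq (α) : ((χ ∘ q) * ρ α) x = ρ α x := by
      rw [Pi.mul_apply, Function.comp_apply, show q x = u from hx, hu, Pi.one_apply, one_mul]
    exact ⟨heq, (Finset.sum_congr rfl fun α _ => heq α).trans (hgood x hx).2⟩

end Cutoff

section Chart

variable {n m : ℕ} {R : ℝ} {i : Fin (n + 1)} {ε : ℤˣ} {Φ : SuperMap n (2 * m) (n + 1) (2 * m)}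
  {ρ σ : (Fin (n + 1) → ℝ) → ℝ}

theorem IsHemisphereChart.integrand_eq_iteratedDeriv_hemisphereKernel
    (hΦ : IsHemisphereChart R i ε Φ) (hR : 0 < R) (hρ : ContDiff ℝ ∞ ρ)
    (hσρ : ∀ᶠ u in nhds (R ^ 2), ∀ x, ∑ A, x A ^ 2 = u → σ x = ρ x) {y : Fin n → ℝ}
    (hy : y ∈ Φ.domain) :
    Φ.integrand (euclideanMetric (n + 1) m) ρ y = 2 ^ m * R *
      iteratedDeriv m (hemisphereKernel i ε σ y) (R ^ 2 - ∑ j, y j ^ 2) := by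
  rw [hΦ.integrand_eq_iteratedDeriv hR hy hρ]
  congr 1
  refine Filter.EventuallyEq.iteratedDeriv_eq m ?_
  have hshift := ((continuous_add_const (∑ j, y j ^ 2)).tendsto' _ _
    (sub_add_cancel (R ^ 2) (∑ j, y j ^ 2))).eventually hσρ
  filter_upwards [hshift, lt_mem_nhds (hΦ.sq_sub_sum_sq_pos hy)] with w hw hw0
  rw [hemisphereKernel, hw]
  rw [sum_insertNth_sq, sign_mul_sq, Real.sq_sqrt hw0.le]

theorem IsHemisphereChart.integrableOn_integrand (hΦ : IsHemisphereChart R i ε Φ) (hR : 0 < R)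
    (hρ : ContDiff ℝ ∞ ρ) (hσ : ContDiff ℝ ∞ σ) (hc : HasCompactSupport σ)
    (hpos : ∀ x ∈ tsupport σ, 0 < ((ε : ℤ) : ℝ) * x i)
    (hσρ : ∀ᶠ u in nhds (R ^ 2), ∀ x, ∑ A, x A ^ 2 = u → σ x = ρ x) :
    IntegrableOn (Φ.integrand (euclideanMetric (n + 1) m) ρ) Φ.domain :=
  ((integrable_iteratedDeriv_hemisphereKernel m hσ hc hpos (R ^ 2)).const_mul
    (2 ^ m * R)).integrableOn.congr_fun
    (fun _ hy => (hΦ.integrand_eq_iteratedDeriv_hemisphereKernel hR hρ hσρ hy).symm)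
    Φ.isOpen_domain.measurableSet

theorem IsHemisphereChart.integral_integrand (hΦ : IsHemisphereChart R i ε Φ) (hR : 0 < R)
    (hρ : ContDiff ℝ ∞ ρ) (hσ : ContDiff ℝ ∞ σ) (hc : HasCompactSupport σ)
    (hpos : ∀ x ∈ tsupport σ, 0 < ((ε : ℤ) : ℝ) * x i)
    (hσρ : ∀ᶠ u in nhds (R ^ 2), ∀ x, ∑ A, x A ^ 2 = u → σ x = ρ x) :
    ∫ y in Φ.domain, Φ.integrand (euclideanMetric (n + 1) m) ρ y =
      2 ^ m * R * iteratedDeriv m (hemisphereIntegral i ε σ) (R ^ 2) := by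
  rw [setIntegral_congr_fun Φ.isOpen_domain.measurableSet fun y hy =>
    hΦ.integrand_eq_iteratedDeriv_hemisphereKernel hR hρ hσρ hy, integral_const_mul,
    iteratedDeriv_hemisphereIntegral m hσ hc hpos]
  congr 1
  refine setIntegral_eq_integral_of_forall_compl_eq_zero fun y hy =>
    iteratedDeriv_hemisphereKernel_of_nonpos hc hpos m y (sub_nonpos.mpr ?_)
  rw [hΦ.domain_eq] at hy
  exact not_lt.mp hy

end Chart

section TotalVolume

theorem descPochhammer_eval_eq_Gamma_div (m : ℕ) {s : ℝ} (hs : 0 < s) :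
    (descPochhammer ℝ m).eval (s - 1) = Real.Gamma s / Real.Gamma (s - m) := by
  induction m with
  | zero => simp [div_self (Real.Gamma_pos_of_pos hs).ne']
  | succ m ih =>
    rw [descPochhammer_succ_eval, ih, Nat.cast_succ, ← sub_sub, sub_right_comm s 1]
    rcases eq_or_ne (s - m - 1) 0 with hpole | hne
    · rw [hpole, Real.Gamma_zero, mul_zero, div_zero]
    · rw [← sub_add_cancel (s - m) 1, Real.Gamma_add_one hne, add_sub_cancel_right,
        div_mul_eq_mul_div, mul_comm, mul_div_mul_left _ _ hne]

/-- The density at `u` of the pushforward of `2 dx` on `ℝ^{n+1}` under `x ↦ |x|²`; at `u = 1` it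
is the volume of the unit sphere. -/
def sphereDensity (n : ℕ) (u : ℝ) : ℝ :=
  2 * Real.pi ^ (((n : ℝ) + 1) / 2) / Real.Gamma (((n : ℝ) + 1) / 2) * u ^ (((n : ℝ) + 1) / 2 - 1)

variable {n : ℕ} {σ : Fin (n + 1) × ℤˣ → (Fin (n + 1) → ℝ) → ℝ}

theorem setIntegral_sum_hemisphereIntegral (hσ : ∀ α, ContDiff ℝ ∞ (σ α))
    (hc : ∀ α, HasCompactSupport (σ α))
    (hpos : ∀ α, ∀ x ∈ tsupport (σ α), 0 < ((α.2 : ℤ) : ℝ) * x α.1) {B : Set ℝ}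
    (hB : MeasurableSet B) (hsum : ∀ x, ∑ i, x i ^ 2 ∈ B → ∑ α, σ α x = 1) :
    ∫ v in B, ∑ α, hemisphereIntegral α.1 α.2 (σ α) v =
      2 * volume.real {x : Fin (n + 1) → ℝ | ∑ i, x i ^ 2 ∈ B} := by
  calc
    ∫ v in B, ∑ α, hemisphereIntegral α.1 α.2 (σ α) v
      = ∑ α, 2 * ∫ x in {x | ∑ i, x i ^ 2 ∈ B}, σ α x := by
      rw [integral_finsetSum _ fun α _ =>
        (integrable_hemisphereIntegral (hσ α) (hc α) (hpos α)).integrableOn]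
      exact Finset.sum_congr rfl fun α _ =>
        setIntegral_hemisphereIntegral (hσ α) (hc α) (hpos α) hB
    _ = 2 * ∫ x in {x | ∑ i, x i ^ 2 ∈ B}, ∑ α, σ α x := by
      rw [← Finset.mul_sum, integral_finsetSum _ fun α _ =>
        ((hσ α).continuous.integrable_of_hasCompactSupport (hc α)).integrableOn]
    _ = 2 * volume.real {x : Fin (n + 1) → ℝ | ∑ i, x i ^ 2 ∈ B} := by
      rw [setIntegral_congr_fun (measurableSet_sum_sq_mem hB) (g := fun _ => (1 : ℝ)) hsum,
        setIntegral_const, smul_eq_mul, mul_one]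

theorem hasDerivAt_two_mul_ballVolume (n : ℕ) (c : ℝ) {u : ℝ} (hu : 0 < u) :
    HasDerivAt (fun u => 2 * ((u ^ (((n : ℝ) + 1) / 2) - c) *
      (Real.pi ^ (((n : ℝ) + 1) / 2) / Real.Gamma (((n : ℝ) + 1) / 2 + 1))))
      (sphereDensity n u) u := by
  have hs : 0 < ((n : ℝ) + 1) / 2 := by positivity
  have hΓ := (Real.Gamma_pos_of_pos hs).ne'
  refine ((((Real.hasDerivAt_rpow_const (Or.inl hu.ne')).sub_const c).mul_const _).const_mul
    2).congr_deriv ?_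
  rw [sphereDensity, Real.Gamma_add_one hs.ne']
  field_simp

theorem sum_hemisphereIntegral_eventuallyEq {r : ℝ} (hr : 0 < r) (hσ : ∀ α, ContDiff ℝ ∞ (σ α))
    (hc : ∀ α, HasCompactSupport (σ α))
    (hpos : ∀ α, ∀ x ∈ tsupport (σ α), 0 < ((α.2 : ℤ) : ℝ) * x α.1)
    (hsum : ∀ᶠ u in nhds r, ∀ x, ∑ i, x i ^ 2 = u → ∑ α, σ α x = 1) :
    (fun u => ∑ α, hemisphereIntegral α.1 α.2 (σ α) u) =ᶠ[nhds r]
      sphereDensity n := by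
  set Ψ : ℝ → ℝ := fun u => ∑ α, hemisphereIntegral α.1 α.2 (σ α) u
  have hΨ : Continuous Ψ := continuous_finsetSum _ fun α _ =>
    (contDiff_hemisphereIntegral (hσ α) (hc α) (hpos α)).continuous
  obtain ⟨a, b, ⟨har, hrb⟩, hab⟩ := mem_nhds_iff_exists_Ioo_subset.mp
    (hsum.and (lt_mem_nhds hr))
  obtain ⟨c, hac, hcr⟩ := exists_between har
  have hc0 : 0 < c := (hab ⟨hac, hcr.trans hrb⟩).2
  have integral_eq (u : ℝ) (hu : u ∈ Set.Ioo c b) :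
      ∫ v in c..u, Ψ v = 2 * ((u ^ (((n : ℝ) + 1) / 2) - c ^ (((n : ℝ) + 1) / 2)) *
        (Real.pi ^ (((n : ℝ) + 1) / 2) / Real.Gamma (((n : ℝ) + 1) / 2 + 1))) := by
    rw [intervalIntegral.integral_of_le hu.1.le, setIntegral_sum_hemisphereIntegral hσ hc hpos
      measurableSet_Ioc fun x hx => (hab ⟨hac.trans hx.1, hx.2.trans_lt hu.2⟩).1 x rfl,
      volume_real_sum_sq_mem_Ioc n hc0.le hu.1.le]
  filter_upwards [Ioo_mem_nhds hcr hrb] with u hu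
  exact (hΨ.integral_hasStrictDerivAt c u).hasDerivAt.unique
    ((hasDerivAt_two_mul_ballVolume n (c ^ (((n : ℝ) + 1) / 2))
      (hc0.trans hu.1)).congr_of_eventuallyEq <| by
        filter_upwards [Ioo_mem_nhds hu.1 hu.2] with v hv using integral_eq v hv)

theorem iteratedDeriv_sphereDensity (n m : ℕ) {R : ℝ} (hR : 0 < R) :
    2 ^ m * R * iteratedDeriv m (sphereDensity n) (R ^ 2) =
      2 * R ^ ((n : ℤ) - 2 * (m : ℤ)) *
        (Real.pi ^ (((n : ℝ) + 1) / 2) * 2 ^ m / Real.Gamma (((n : ℝ) + 1) / 2 - m)) := by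
  have hs : 0 < ((n : ℝ) + 1) / 2 := by positivity
  have hΓ := (Real.Gamma_pos_of_pos hs).ne'
  have hpow : (R ^ 2) ^ (((n : ℝ) + 1) / 2 - 1 - m) * R = R ^ ((n : ℤ) - 2 * (m : ℤ)) := by
    rw [← Real.rpow_two, ← Real.rpow_mul hR.le, ← Real.rpow_intCast, ← Real.rpow_add_one hR.ne']
    congr 1
    push_cast
    ring
  unfold sphereDensity
  rw [iteratedDeriv_const_mul_field, iteratedDeriv_eq_iterate, Real.iter_deriv_rpow_const,
    descPochhammer_eval_eq_Gamma_div m hs, ← hpow]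
  field_simp

theorem hasSupersphereVolume (n m : ℕ) {R : ℝ} (hR : 0 < R) :
    HasSupersphereVolume n m R
      (2 * R ^ ((n : ℤ) - 2 * (m : ℤ)) *
        (Real.pi ^ (((n : ℝ) + 1) / 2) * 2 ^ m / Real.Gamma (((n : ℝ) + 1) / 2 - m))) := by
  refine ⟨⟨fun α => hemisphereChart n m R α.1 α.2, fun α =>
    isHemisphereChart_hemisphereChart n m R α.1 α.2⟩, exists_isHemispherePartition n hR,
    fun Φ ρ hΦ hρ => ?_⟩
  obtain ⟨σ, hσ, hc, hpos, hσρ⟩ := hρ.exists_cutoff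
  have heq (α) : ∀ᶠ u in nhds (R ^ 2), ∀ x, ∑ i, x i ^ 2 = u → σ α x = ρ α x :=
    hσρ.mono fun _ h x hx => (h x hx).1 α
  have hsum : ∀ᶠ u in nhds (R ^ 2), ∀ x, ∑ i, x i ^ 2 = u → ∑ α, σ α x = 1 :=
    hσρ.mono fun _ h x hx => (h x hx).2
  refine ⟨fun α => (hΦ α).integrableOn_integrand hR (hρ.smooth α) (hσ α) (hc α) (hpos α) (heq α),
    ?_⟩
  calc
    ∑ α, ∫ y in (Φ α).domain, (Φ α).integrand (euclideanMetric (n + 1) m) (ρ α) y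
      = 2 ^ m * R * iteratedDeriv m
          (fun u => ∑ α, hemisphereIntegral α.1 α.2 (σ α) u) (R ^ 2) := by
      rw [Finset.sum_congr rfl fun α _ => (hΦ α).integral_integrand hR (hρ.smooth α) (hσ α) (hc α)
        (hpos α) (heq α), ← Finset.mul_sum, iteratedDeriv_fun_sum fun α _ => ContDiff.contDiffAt
        (contDiff_infty.mp (contDiff_hemisphereIntegral (hσ α) (hc α) (hpos α)) m)]
    _ = 2 ^ m * R * iteratedDeriv m (sphereDensity n) (R ^ 2) := by
      rw [(sum_hemisphereIntegral_eventuallyEq (by positivity) hσ hc hpos hsum).iteratedDeriv_eq]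
    _ = _ := iteratedDeriv_sphereDensity n m hR

end TotalVolume

end Supergeometry

end

theorem mainTheorem1 (R : ℝ) (hR : 0 < R) :
    (∀ n m : ℕ, Supergeometry.HasSupersphereVolume n m R
      (2 * R ^ ((n : ℤ) - 2 * (m : ℤ)) *
        (Real.pi ^ (((n : ℝ) + 1) / 2) * 2 ^ m / Real.Gamma (((n : ℝ) + 1) / 2 - (m : ℝ))))) ∧
    (∀ n m : ℕ, n < m → Supergeometry.HasSupersphereVolume (2 * n + 1) m R 0) := by
  refine ⟨fun n m => Supergeometry.hasSupersphereVolume n m hR, fun n m hnm => ?_⟩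
  have h := Supergeometry.hasSupersphereVolume (2 * n + 1) m hR
  have harg : (((2 * n + 1 : ℕ) : ℝ) + 1) / 2 - (m : ℝ) = -((m - n - 1 : ℕ) : ℝ) := by
    rw [Nat.sub_sub, Nat.cast_sub hnm]
    push_cast
    ring
  rwa [harg, Real.Gamma_neg_nat_eq_zero, div_zero, mul_zero] at h
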